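/- Let $M$ be a smooth (Hausdorff, second countable, finite-dimensional) manifold with an almost complex structure $j$, let $D\subset TM$ be a smooth distribution which is regular (of constant dimension), involutive and $j$-stable ($jD\subset D$), and let $\mathcal D=\Gamma^\infty(D)$ be its space of smooth sections. Suppose that the space of leaves $M/D$ (the set of maximal connected integral manifolds of $D$) has a structure of smooth manifold for which the canonical projection $\pi:M\to M/D$ is a submersion, and that $j$ induces a complex structure on $M/D$, i.e. there is an almost complex structure $\hat\jmath$ on $M/D$ with vanishing Nijenhuis tensor such that $d\pi\circ j=\hat\jmath\circ d\pi$. For a space $\mathcal V$ of smooth vector fields on $M$, let $\Omega^{p,q}_{\mathcal V,[j]}$ be the space of smooth complex forms $\omega$ of type $(p,q)$ with respect to $j$ which are $\mathcal V$-transverse, i.e. $\iota(F)\omega=0$ and $\mathcal L_F\omega=0$ for all $F\in\mathcal V$; let $\bar\partial\omega$ be the component of type $(p,q+1)$ of $d\omega$, and put $$H^{p,q}_{\mathcal V,[j],\bar\partial}(M)=\operatorname{Ker}\bar\partial|_{\Omega^{p,q}_{\mathcal V,[j]}}\big/\operatorname{Im}\bar\partial|_{\Omega^{p,q-1}_{\mathcal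 V,[j]}}$$ (the denominator being $0$ for $q=0$). For $\mathcal V=\mathcal D$ this is the $\mathcal D$-transverse Dolbeault cohomology induced by $j$. The $j$-transverse Dolbeault cohomology $H^{p,q}_{j\,trans}(M)$ is the case $\mathcal V=\mathcal D_j^\infty=\bigcup_{k\ge1}\mathcal D_j^{(k)}$, where $N^j$ is the Nijenhuis tensor, $\mathcal D_j^{(1)}$ is the space of smooth sections of the distribution spanned pointwise by the values of $N^j$, and $$\mathcal D_j^{(k+1)}=\mathcal D_j^{(k)}+\sum_{U\in\mathcal D_j^{(k)}}\operatorname{Im}(\mathcal L_Uj)+[\mathcal D_j^{(k)},\mathcal D_j^{(k)}].$$ Then $j$ defines a $\mathcal D$-transverse complex structure, i.e. $j\mathcal D\subset\mathcal D$, $j^2U+U\in\mathcal D$, $[F,jU]-j[F,U]\in\mathcal D$ and $N^j(U,V)\in\mathcal D$ for all $F\in\mathcal D$ and all smooth vector fields $U,V$ on $M$; and for all $p,q\ge0$: (1) the pullback $\pi^*$ of forms induces an isomorphism of complex vector spaces from the Dolbeault cohomology $H^{p,q}_{\hat\jmath,\bar\partial}(M/D)$ of the space of leaves onto the $\mathcal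 D$-transverse Dolbeault cohomology $H^{p,q}_{\mathcal D,[j],\bar\partial}(M)$; (2) the inclusion of forms induces a linear map $H^{p,q}_{\mathcal D,[j],\bar\partial}(M)\to H^{p,q}_{j\,trans}(M)$. -/

import Mathlib

open scoped Manifold ContDiff Topology

universe u

noncomputable section

/-! ### Linear algebra: `(p,q)`-types of complex valued alternating forms -/

section LinearAlgebra

variable {V : Type*} [AddCommGroup V] [Module ℝ V] [TopologicalSpace V] {n : ℕ}

/-- Let slot `r` carry the vector `½(v r - i J v r)` if `r ∈ P` and `½(v r + i J v r)` otherwise;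
this is the value on these vectors of the `ℂ`-multilinear extension of `α` to `V ⊗ ℂ`, expanded by
multilinearity (`S` is the set of slots in which the summand `J v r` has been picked). -/
def evalTypes (J : V →L[ℝ] V) (α : V [⋀^Fin n]→L[ℝ] ℂ) (P : Finset (Fin n)) (v : Fin n → V) : ℂ :=
  (1 / 2 : ℂ) ^ n * ∑ S : Finset (Fin n),
    (∏ r ∈ S, if r ∈ P then -Complex.I else Complex.I) *
      α (fun r => if r ∈ S then J (v r) else v r)

/-- `α`, a form of degree `n = p + q`, is of type `(p,q)` for `J`: it vanishes on all families made
of vectors of type `(1,0)` and `(0,1)` unless exactly `p` of them are of type `(1,0)`. -/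
def IsOfType (J : V →L[ℝ] V) (p : ℕ) (α : V [⋀^Fin n]→L[ℝ] ℂ) : Prop :=
  ∀ P : Finset (Fin n), P.card ≠ p → ∀ v, evalTypes J α P v = 0

lemma evalTypes_add (J : V →L[ℝ] V) (α η : V [⋀^Fin n]→L[ℝ] ℂ) (P : Finset (Fin n))
    (v : Fin n → V) : evalTypes J (α + η) P v = evalTypes J α P v + evalTypes J η P v := by
  simp only [evalTypes, ContinuousAlternatingMap.add_apply, mul_add, Finset.sum_add_distrib]

lemma evalTypes_smul (J : V →L[ℝ] V) (c : ℂ) (α : V [⋀^Fin n]→L[ℝ] ℂ) (P : Finset (Fin n))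
    (v : Fin n → V) : evalTypes J (c • α) P v = c * evalTypes J α P v := by
  simp only [evalTypes, ContinuousAlternatingMap.smul_apply, smul_eq_mul, Finset.mul_sum]
  exact Finset.sum_congr rfl fun _ _ => by ring

lemma evalTypes_zero (J : V →L[ℝ] V) (P : Finset (Fin n)) (v : Fin n → V) :
    evalTypes J (0 : V [⋀^Fin n]→L[ℝ] ℂ) P v = 0 := by
  simp [evalTypes]

lemma evalTypes_map_swap (J : V →L[ℝ] V) (α : V [⋀^Fin n]→L[ℝ] ℂ) (P : Finset (Fin n))
    {v : Fin n → V} {a b : Fin n} (hv : v a = v b) (hab : a ≠ b) :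
    evalTypes J α (P.map (Equiv.swap a b).toEmbedding) v = - evalTypes J α P v := by
  have hvs : ∀ r, v (Equiv.swap a b r) = v r := by
    intro r
    by_cases h1 : r = a
    · subst h1; simp [hv]
    by_cases h2 : r = b
    · subst h2; simp [hv]
    rw [Equiv.swap_apply_of_ne_of_ne h1 h2]
  unfold evalTypes
  rw [← mul_neg, ← Finset.sum_neg_distrib]
  congr 1
  rw [← Equiv.sum_comp (Equiv.finsetCongr (Equiv.swap a b))]
  refine Finset.sum_congr rfl fun S _ => ?_
  have h1 : (∏ r ∈ (Equiv.finsetCongr (Equiv.swap a b)) S,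
      if r ∈ P.map (Equiv.swap a b).toEmbedding then -Complex.I else Complex.I)
      = ∏ r ∈ S, if r ∈ P then -Complex.I else Complex.I := by
    rw [Equiv.finsetCongr_apply, Finset.prod_map]
    refine Finset.prod_congr rfl fun r _ => ?_
    simp
  have h2 : (fun r => if r ∈ (Equiv.finsetCongr (Equiv.swap a b)) S then J (v r) else v r)
      = (fun r => if r ∈ S then J (v r) else v r) ∘ Equiv.swap a b := by
    funext r
    simp [Finset.mem_map_equiv, hvs]
  rw [h1, h2, ← mul_neg]
  congr 1
  exact α.toAlternatingMap.map_swap _ hab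

/-- Auxiliary: the type projection as a multilinear map. -/
def typeProjAux (J : V →L[ℝ] V) (p : ℕ) (α : V [⋀^Fin n]→L[ℝ] ℂ) :
    ContinuousMultilinearMap ℝ (fun _ : Fin n => V) ℂ :=
  ∑ P ∈ (Finset.univ : Finset (Fin n)).powersetCard p, (1 / 2 : ℂ) ^ n • ∑ S : Finset (Fin n),
    (∏ r ∈ S, if r ∈ P then -Complex.I else Complex.I) •
      α.toContinuousMultilinearMap.compContinuousLinearMap
        (fun r => if r ∈ S then J else ContinuousLinearMap.id ℝ V)

lemma typeProjAux_apply (J : V →L[ℝ] V) (p : ℕ) (α : V [⋀^Fin n]→L[ℝ] ℂ) (v : Fin n → V) :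
    typeProjAux J p α v
      = ∑ P ∈ (Finset.univ : Finset (Fin n)).powersetCard p, evalTypes J α P v := by
  rw [typeProjAux, sum_apply]
  refine Finset.sum_congr rfl fun P _ => ?_
  rw [evalTypes, smul_apply, sum_apply,
    smul_eq_mul]
  congr 1
  refine Finset.sum_congr rfl fun S _ => ?_
  rw [smul_apply, smul_eq_mul,
    ContinuousMultilinearMap.compContinuousLinearMap_apply]
  congr 1
  refine congrArg α (funext fun r => ?_)
  split_ifs <;> rfl

/-- The component of `α` of type `(p, n - p)`: since `v = ½(v - i J v) + ½(v + i J v)` for every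
slot, `α v` is the sum of all `evalTypes J α P v`; keep the terms with exactly `p` vectors of type
`(1,0)`. See `typeProj_apply`. -/
def typeProj (J : V →L[ℝ] V) (p : ℕ) (α : V [⋀^Fin n]→L[ℝ] ℂ) : V [⋀^Fin n]→L[ℝ] ℂ where
  toContinuousMultilinearMap := typeProjAux J p α
  map_eq_zero_of_eq' := by
    intro v a b hv hab
    have h : ∑ P ∈ (Finset.univ : Finset (Fin n)).powersetCard p, evalTypes J α P v
        = ∑ P ∈ (Finset.univ : Finset (Fin n)).powersetCard p, - evalTypes J α P v := by
      symm
      refine Finset.sum_equiv (Equiv.finsetCongr (Equiv.swap a b)) ?_ ?_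
      · intro P; simp [Finset.mem_powersetCard]
      · intro P _
        rw [Equiv.finsetCongr_apply, evalTypes_map_swap J α P hv hab]
    rw [Finset.sum_neg_distrib] at h
    exact (typeProjAux_apply J p α v).trans (self_eq_neg.mp h)

lemma typeProj_apply (J : V →L[ℝ] V) (p : ℕ) (α : V [⋀^Fin n]→L[ℝ] ℂ) (v : Fin n → V) :
    typeProj J p α v = ∑ P ∈ (Finset.univ : Finset (Fin n)).powersetCard p, evalTypes J α P v :=
  typeProjAux_apply J p α v

lemma typeProj_add (J : V →L[ℝ] V) (p : ℕ) (α β : V [⋀^Fin n]→L[ℝ] ℂ) :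
    typeProj J p (α + β) = typeProj J p α + typeProj J p β := by
  ext v
  simp only [ContinuousAlternatingMap.add_apply, typeProj_apply, evalTypes_add,
    Finset.sum_add_distrib]

lemma typeProj_smul (J : V →L[ℝ] V) (p : ℕ) (c : ℂ) (α : V [⋀^Fin n]→L[ℝ] ℂ) :
    typeProj J p (c • α) = c • typeProj J p α := by
  ext v
  simp only [ContinuousAlternatingMap.smul_apply, typeProj_apply, evalTypes_smul,
    Finset.mul_sum, smul_eq_mul]

end LinearAlgebra

/-! ### Fields and forms on a manifold

A smooth manifold `M` of dimension `dim E` is modelled on the finite dimensional real vector space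
`E`, with the model with corners `𝓘(ℝ, E)`. -/

section Manifold

variable (E : Type*) [NormedAddCommGroup E] [NormedSpace ℝ E]
  (M : Type u) [TopologicalSpace M] [ChartedSpace E M]

/-- Vector fields (not necessarily smooth). -/
abbrev VField := (x : M) → TangentSpace 𝓘(ℝ, E) x

/-- Fields of endomorphisms of the tangent spaces (not necessarily smooth). -/
abbrev EndField := (x : M) → TangentSpace 𝓘(ℝ, E) x →L[ℝ] TangentSpace 𝓘(ℝ, E) x

/-- Complex valued differential forms of degree `n` (not necessarily smooth). -/
def CForm (n : ℕ) := (x : M) → TangentSpace 𝓘(ℝ, E) x [⋀^Fin n]→L[ℝ] ℂ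

instance (n : ℕ) : AddCommGroup (CForm E M n) :=
  inferInstanceAs (AddCommGroup ((x : M) → TangentSpace 𝓘(ℝ, E) x [⋀^Fin n]→L[ℝ] ℂ))

instance (n : ℕ) : Module ℂ (CForm E M n) :=
  inferInstanceAs (Module ℂ ((x : M) → TangentSpace 𝓘(ℝ, E) x [⋀^Fin n]→L[ℝ] ℂ))

/-- Distributions of tangent subspaces (not necessarily smooth, nor of constant rank). -/
abbrev TangentDistribution := (x : M) → Submodule ℝ (TangentSpace 𝓘(ℝ, E) x)

/-! ### Smooth forms, exterior derivative -/

variable {E M} {n : ℕ}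

/-- The derivative at `x` of the preferred chart at `x`. -/
def chartDeriv (x : M) : TangentSpace 𝓘(ℝ, E) x →L[ℝ] E :=
  mfderiv 𝓘(ℝ, E) 𝓘(ℝ, E) (extChartAt 𝓘(ℝ, E) x) x

/-- The derivative at `y` of the inverse of the preferred chart at `x₀`. -/
def chartSymmDeriv (x₀ : M) (y : E) :
    E →L[ℝ] TangentSpace 𝓘(ℝ, E) ((extChartAt 𝓘(ℝ, E) x₀).symm y) :=
  mfderiv 𝓘(ℝ, E) 𝓘(ℝ, E) (extChartAt 𝓘(ℝ, E) x₀).symm y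

/-- The expression of a form in the preferred chart at `x₀`. -/
def CForm.inChart (α : CForm E M n) (x₀ : M) (y : E) : E [⋀^Fin n]→L[ℝ] ℂ :=
  (α ((extChartAt 𝓘(ℝ, E) x₀).symm y)).compContinuousLinearMap (chartSymmDeriv x₀ y)

lemma CForm.inChart_add (α β : CForm E M n) (x₀ : M) :
    (α + β).inChart x₀ = α.inChart x₀ + β.inChart x₀ := rfl

lemma CForm.inChart_smul (c : ℂ) (α : CForm E M n) (x₀ : M) :
    (c • α).inChart x₀ = c • α.inChart x₀ := rfl

variable (E M n) in
/-- The space `Ω^n(M, ℂ)` of smooth complex `n`-forms. -/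
def smoothForms : Submodule ℂ (CForm E M n) where
  carrier := {α | ∀ x₀ : M, ContDiffOn ℝ ∞ (α.inChart x₀) (extChartAt 𝓘(ℝ, E) x₀).target}
  zero_mem' := fun _ => contDiffOn_const (c := (0 : E [⋀^Fin n]→L[ℝ] ℂ))
  add_mem' := fun ha hb x₀ => (ha x₀).add (hb x₀)
  smul_mem' := fun c _ ha x₀ => (ha x₀).const_smul c

lemma CForm.differentiableAt_inChart {α : CForm E M n} (hα : α ∈ smoothForms E M n) (x₀ : M)
    {y : E}
    (hy : y ∈ (extChartAt 𝓘(ℝ, E) x₀).target) : DifferentiableAt ℝ (α.inChart x₀) y :=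
  (ContDiffOn.contDiffAt (hα x₀) ((isOpen_extChartAt_target x₀).mem_nhds hy)).differentiableAt (by simp)

/-- The exterior derivative, computed at `x` in the preferred chart at `x`. -/
def CForm.extDer (α : CForm E M n) : CForm E M (n + 1) := fun x =>
  (extDeriv (α.inChart x) (extChartAt 𝓘(ℝ, E) x x)).compContinuousLinearMap (chartDeriv x)

lemma CForm.extDer_add {α β : CForm E M n} (hα : α ∈ smoothForms E M n)
    (hβ : β ∈ smoothForms E M n) (x : M) : (α + β).extDer x = α.extDer x + β.extDer x := by
  have h := extDeriv_add (CForm.differentiableAt_inChart hα x (mem_extChartAt_target x))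
    (CForm.differentiableAt_inChart hβ x (mem_extChartAt_target x))
  simp only [CForm.extDer, CForm.inChart_add, h]
  rfl

lemma CForm.extDer_smul (c : ℂ) {α : CForm E M n} (hα : α ∈ smoothForms E M n) (x : M) :
    (c • α).extDer x = c • α.extDer x := by
  have h : extDeriv (c • α.inChart x) (extChartAt 𝓘(ℝ, E) x x)
      = c • extDeriv (α.inChart x) (extChartAt 𝓘(ℝ, E) x x) := by
    rw [extDeriv, extDeriv, fderiv_const_smul
      (CForm.differentiableAt_inChart hα x (mem_extChartAt_target x)) c,
      ContinuousAlternatingMap.alternatizeUncurryFin_smul]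
  simp only [CForm.extDer, CForm.inChart_smul, h]
  rfl

/-- The function `α(X₁, …, Xₙ)`. -/
def CForm.evalOn (α : CForm E M n) (X : Fin n → VField E M) (x : M) : ℂ := α x fun i => X i x

/-- `ι(F) α = 0`. -/
def CForm.ContractionVanishes (F : VField E M) (α : CForm E M n) : Prop :=
  ∀ (x : M) (v : Fin n → TangentSpace 𝓘(ℝ, E) x), (∃ i, v i = F x) → α x v = 0

variable [IsManifold 𝓘(ℝ, E) ∞ M]

/-! ### Vector fields, almost complex structures, distributions -/

/-- Smoothness of a vector field on a set. -/
def VField.SmoothOn (X : VField E M) (U : Set M) : Prop :=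
  ContMDiffOn 𝓘(ℝ, E) 𝓘(ℝ, E).tangent ∞ (fun x => (⟨x, X x⟩ : TangentBundle 𝓘(ℝ, E) M)) U

/-- Smooth vector fields. -/
def VField.Smooth (X : VField E M) : Prop :=
  ContMDiff 𝓘(ℝ, E) 𝓘(ℝ, E).tangent ∞ (fun x => (⟨x, X x⟩ : TangentBundle 𝓘(ℝ, E) M))

/-- The Lie bracket of vector fields. -/
def VField.bracket (X Y : VField E M) : VField E M := VectorField.mlieBracket 𝓘(ℝ, E) X Y

/-- The vector field `k X`. -/
def EndField.app (k : EndField E M) (X : VField E M) : VField E M := fun x => k x (X x)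

/-- Smooth sections of `End(TM)`. -/
def EndField.Smooth (k : EndField E M) : Prop :=
  ContMDiff 𝓘(ℝ, E) (𝓘(ℝ, E).prod 𝓘(ℝ, E →L[ℝ] E)) ∞
    (fun x => Bundle.TotalSpace.mk' (E →L[ℝ] E)
      (E := fun x : M => TangentSpace 𝓘(ℝ, E) x →L[ℝ] TangentSpace 𝓘(ℝ, E) x) x (k x))

/-- The Lie derivative of a field of endomorphisms, `(L_F k) U = [F, k U] - k [F, U]`. -/
def EndField.lieDeriv (F : VField E M) (k : EndField E M) (U : VField E M) : VField E M :=
  F.bracket (k.app U) - k.app (F.bracket U)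

/-- The Nijenhuis tensor `N^k(X, Y) = [kX, kY] - k[kX, Y] - k[X, kY] + k²[X, Y]`. -/
def EndField.nijenhuis (k : EndField E M) (X Y : VField E M) : VField E M :=
  (k.app X).bracket (k.app Y) - k.app ((k.app X).bracket Y) - k.app (X.bracket (k.app Y))
    + k.app (k.app (X.bracket Y))

variable (E M) in
/-- Almost complex structures on `M`. -/
structure AlmostComplexStructure where
  /-- the underlying field of endomorphisms -/
  toField : EndField E M
  smooth : toField.Smooth
  sq : ∀ x (v : TangentSpace 𝓘(ℝ, E) x), toField x (toField x v) = -v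

/-- An almost complex structure is a complex structure (is integrable) iff its Nijenhuis tensor
vanishes. -/
def AlmostComplexStructure.IsIntegrable (j : AlmostComplexStructure E M) : Prop :=
  ∀ X Y : VField E M, X.Smooth → Y.Smooth → j.toField.nijenhuis X Y = 0

/-- A distribution is smooth if, near every point, finitely many smooth vector fields span it. -/
def TangentDistribution.IsSmooth (D : TangentDistribution E M) : Prop :=
  ∀ x₀ : M, ∃ U ∈ 𝓝 x₀, ∃ (m : ℕ) (X : Fin m → VField E M),
    (∀ i, (X i).SmoothOn U) ∧ ∀ x ∈ U, D x = Submodule.span ℝ (Set.range fun i => X i x)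

/-- A distribution is regular if it has constant dimension. -/
def TangentDistribution.IsRegular (D : TangentDistribution E M) : Prop :=
  ∃ r : ℕ, ∀ x, Module.finrank ℝ (D x) = r

/-- The space `Γ^∞(D)` of smooth (global) sections of a distribution. -/
def TangentDistribution.sections (D : TangentDistribution E M) : Set (VField E M) :=
  {X | X.Smooth ∧ ∀ x, X x ∈ D x}

/-- A space of vector fields is involutive if it is closed under brackets. -/
def IsInvolutive (𝒟 : Set (VField E M)) : Prop :=
  ∀ X ∈ 𝒟, ∀ Y ∈ 𝒟, X.bracket Y ∈ 𝒟

/-- The field of endomorphisms `k` defines a `𝒟`-transverse complex structure. -/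
structure IsTransverseComplexStructure (𝒟 : Set (VField E M)) (k : EndField E M) : Prop where
  smooth : k.Smooth
  stable : ∀ F ∈ 𝒟, k.app F ∈ 𝒟
  sq : ∀ U : VField E M, U.Smooth → k.app (k.app U) + U ∈ 𝒟
  lie : ∀ F ∈ 𝒟, ∀ U : VField E M, U.Smooth → k.lieDeriv F U ∈ 𝒟
  nijenhuis : ∀ U V : VField E M, U.Smooth → V.Smooth → k.nijenhuis U V ∈ 𝒟

/-! ### The involutive limit distribution of an almost complex structure -/

/-- The image distribution `Im N^j`. -/
def AlmostComplexStructure.imNijenhuis (j : AlmostComplexStructure E M) : TangentDistribution E M :=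
  fun x => Submodule.span ℝ
    {v | ∃ X Y : VField E M, X.Smooth ∧ Y.Smooth ∧ v = j.toField.nijenhuis X Y x}

/-- The sequence `𝒟_j^{(k)}`, `k ≥ 1`, with index shifted by one: the first term is the space of
smooth sections of `Im N^j`, and
`𝒟_j^{(k+1)} = 𝒟_j^{(k)} + ∑_{U ∈ 𝒟_j^{(k)}} Im L_U j + [𝒟_j^{(k)}, 𝒟_j^{(k)}]`. -/
def AlmostComplexStructure.derivedSeq (j : AlmostComplexStructure E M) :
    ℕ → Submodule ℝ (VField E M)
  | 0 => Submodule.span ℝ j.imNijenhuis.sections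
  | k + 1 => j.derivedSeq k
      ⊔ Submodule.span ℝ {W | ∃ U ∈ j.derivedSeq k, ∃ X : VField E M, X.Smooth ∧
          W = j.toField.lieDeriv U X}
      ⊔ Submodule.span ℝ {W | ∃ U ∈ j.derivedSeq k, ∃ U' ∈ j.derivedSeq k, W = U.bracket U'}

/-- The involutive limit `𝒟_j^∞ = ⋃_k 𝒟_j^{(k)}`. -/
def AlmostComplexStructure.limitDistribution (j : AlmostComplexStructure E M) :
    Set (VField E M) :=
  ⋃ k, (j.derivedSeq k : Set (VField E M))

/-! ### Lie derivative of forms -/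

/-- The differential at `x` of a complex valued function. -/
def derivC (f : M → ℂ) (x : M) : TangentSpace 𝓘(ℝ, E) x →L[ℝ] ℂ := mfderiv 𝓘(ℝ, E) 𝓘(ℝ, ℂ) f x

/-- The Lie derivative of a form, evaluated on vector fields:
`(L_F α)(X₁, …, Xₙ) = F(α(X₁, …, Xₙ)) - ∑ i, α(X₁, …, [F, X_i], …, Xₙ)`. -/
def CForm.lieDerivOn (F : VField E M) (α : CForm E M n) (X : Fin n → VField E M) (x : M) : ℂ :=
  derivC (α.evalOn X) x (F x) - ∑ i, α.evalOn (Function.update X i (F.bracket (X i))) x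

/-- `L_F α = 0`. -/
def CForm.LieDerivVanishes (F : VField E M) (α : CForm E M n) : Prop :=
  ∀ X : Fin n → VField E M, (∀ i, (X i).Smooth) → ∀ x, α.lieDerivOn F X x = 0

lemma CForm.mdifferentiableAt_evalOn [FiniteDimensional ℝ E]
    {α : CForm E M n} (hα : α ∈ smoothForms E M n)
    {X : Fin n → VField E M} (hX : ∀ i, (X i).Smooth) (x : M) :
    MDifferentiableAt 𝓘(ℝ, E) 𝓘(ℝ, ℂ) (α.evalOn X) x := by
  have : CompleteSpace E := FiniteDimensional.complete ℝ E
  have : IsManifold 𝓘(ℝ, E) 2 M := inferInstance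
  set φ := extChartAt 𝓘(ℝ, E) x with hφ
  let W : Fin n → E → E := fun i y => (chartSymmDeriv x y).inverse (X i (φ.symm y))
  have hW : ∀ i, DifferentiableAt ℝ (W i) (φ x) := by
    intro i
    have h := MDifferentiableWithinAt.differentiableWithinAt_mpullbackWithin_vectorField
      (s := Set.univ) (((hX i) x).mdifferentiableAt (by simp)).mdifferentiableWithinAt
    rw [modelWithCornersSelf_coe, Set.range_id, Set.preimage_univ, Set.univ_inter] at h
    have h' := differentiableWithinAt_univ.mp h
    have e : VectorField.mpullbackWithin 𝓘(ℝ, E) 𝓘(ℝ, E) φ.symm (X i) Set.univ = W i := by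
      funext y
      rw [VectorField.mpullbackWithin_apply, mfderivWithin_univ]
      rfl
    exact e ▸ h'
  have hg : DifferentiableAt ℝ (fun y => α.inChart x y (fun i => W i y)) (φ x) :=
    (CForm.differentiableAt_inChart hα x (mem_extChartAt_target x)).continuousAlternatingMap_apply hW
  have hev : α.evalOn X =ᶠ[𝓝 x] (fun y => α.inChart x y (fun i => W i y)) ∘ φ := by
    filter_upwards [extChartAt_source_mem_nhds (I := 𝓘(ℝ, E)) x] with z hz
    have key : ∀ y ∈ φ.target, α.inChart x y (fun i => W i y) = α.evalOn X (φ.symm y) := by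
      intro y hy
      have hinv := isInvertible_mfderivWithin_extChartAt_symm (I := 𝓘(ℝ, E)) hy
      rw [modelWithCornersSelf_coe, Set.range_id, mfderivWithin_univ] at hinv
      have hinv' : (chartSymmDeriv x y).IsInvertible := hinv
      exact congrArg (α (φ.symm y)) (funext fun i => hinv'.self_apply_inverse _)
    rw [Function.comp_apply, key _ (φ.map_source hz), φ.left_inv hz]
  refine MDifferentiableAt.congr_of_eventuallyEq ?_ hev
  exact hg.mdifferentiableAt.comp x (mdifferentiableAt_extChartAt (mem_chart_source E x))

variable [FiniteDimensional ℝ E]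

lemma CForm.lieDerivOn_add (F : VField E M) {α β : CForm E M n} (hα : α ∈ smoothForms E M n)
    (hβ : β ∈ smoothForms E M n) {X : Fin n → VField E M} (hX : ∀ i, (X i).Smooth) (x : M) :
    (α + β).lieDerivOn F X x = α.lieDerivOn F X x + β.lieDerivOn F X x := by
  have e : derivC ((α + β).evalOn X) x = derivC (α.evalOn X) x + derivC (β.evalOn X) x :=
    mfderiv_add (CForm.mdifferentiableAt_evalOn hα hX x) (CForm.mdifferentiableAt_evalOn hβ hX x)
  have e2 : ∀ Y : Fin n → VField E M, (α + β).evalOn Y x = α.evalOn Y x + β.evalOn Y x :=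
    fun _ => rfl
  simp only [CForm.lieDerivOn, e, e2, Finset.sum_add_distrib, _root_.add_apply]
  ring

lemma CForm.lieDerivOn_smul (F : VField E M) {α : CForm E M n} (c : ℂ)
    (hα : α ∈ smoothForms E M n) {X : Fin n → VField E M} (hX : ∀ i, (X i).Smooth) (x : M) :
    (c • α).lieDerivOn F X x = c * α.lieDerivOn F X x := by
  let m : ℂ →L[ℝ] ℂ := c • ContinuousLinearMap.id ℝ ℂ
  have e : derivC ((c • α).evalOn X) x (F x) = c * derivC (α.evalOn X) x (F x) :=
    DFunLike.congr_fun ((m.hasMFDerivAt (x := α.evalOn X x)).comp x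
      (CForm.mdifferentiableAt_evalOn hα hX x).hasMFDerivAt).mfderiv (F x)
  have e2 : ∀ Y : Fin n → VField E M, (c • α).evalOn Y x = c * α.evalOn Y x := fun _ => rfl
  simp only [CForm.lieDerivOn, e, e2, ← Finset.mul_sum]
  ring

/-! ### Dolbeault cohomology and transverse Dolbeault cohomology -/

/-- The space `Ω_j^{p,q}` of smooth forms of type `(p,q)`. -/
def typeForms (j : AlmostComplexStructure E M) (p q : ℕ) :
    Submodule ℂ (smoothForms E M (p + q)) where
  carrier := {α | ∀ x, IsOfType (j.toField x) p (α.1 x)}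
  zero_mem' := fun x P _ v => by
    exact evalTypes_zero _ _ _
  add_mem' := fun {α β} ha hb x P hP v => by
    have h := evalTypes_add (j.toField x) (α.1 x) (β.1 x) P v
    rw [ha x P hP v, hb x P hP v, add_zero] at h
    exact h
  smul_mem' := fun c α ha x P hP v => by
    have h := evalTypes_smul (j.toField x) c (α.1 x) P v
    rw [ha x P hP v, mul_zero] at h
    exact h

/-- The space `Ω_{𝒟,[j]}^{p,q}` of smooth forms `α` of type `(p,q)` which are `𝒟`-transverse, i.e.
such that `ι(F) α = 0` and `L_F α = 0` for all `F ∈ 𝒟`. -/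
def transverseForms (𝒟 : Set (VField E M)) (j : AlmostComplexStructure E M) (p q : ℕ) :
    Submodule ℂ (smoothForms E M (p + q)) where
  carrier := {α | α ∈ typeForms j p q ∧
    ∀ F ∈ 𝒟, α.1.ContractionVanishes F ∧ α.1.LieDerivVanishes F}
  zero_mem' := by
    refine ⟨zero_mem _, fun F _ => ⟨fun _ _ _ => rfl, ?_⟩⟩
    intro X hX x
    have h := CForm.lieDerivOn_smul F (0 : ℂ) (zero_mem (smoothForms E M (p + q))) hX x
    rwa [zero_smul, zero_mul] at h
  add_mem' := fun {α β} ha hb => ⟨add_mem ha.1 hb.1, fun F hF =>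
    ⟨fun x v hv => by
      have h1 := (ha.2 F hF).1 x v hv
      have h2 := (hb.2 F hF).1 x v hv
      exact (congrArg₂ (· + ·) h1 h2).trans (add_zero 0),
    fun X hX x => by
      have h := CForm.lieDerivOn_add F α.2 β.2 hX x
      rwa [(ha.2 F hF).2 X hX x, (hb.2 F hF).2 X hX x, add_zero] at h⟩⟩
  smul_mem' := fun c α ha => ⟨Submodule.smul_mem _ c ha.1, fun F hF =>
    ⟨fun x v hv => by
      have h1 := (ha.2 F hF).1 x v hv
      exact (congrArg (c * ·) h1).trans (mul_zero c),
    fun X hX x => by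
      have h := CForm.lieDerivOn_smul F c α.2 hX x
      rwa [(ha.2 F hF).2 X hX x, mul_zero] at h⟩⟩

/-- The operator `∂̄` on smooth forms of degree `p + q`, for bidegree `(p,q)`: the exterior
derivative followed by the projection on the component of type `(p,q+1)`. -/
def dbar (j : AlmostComplexStructure E M) (p q : ℕ) :
    smoothForms E M (p + q) →ₗ[ℂ] CForm E M (p + (q + 1)) where
  toFun α := fun x => typeProj (j.toField x) p (α.1.extDer x)
  map_add' := fun α β => by
    funext x
    change typeProj (j.toField x) p ((α.1 + β.1).extDer x) = _
    rw [CForm.extDer_add α.2 β.2]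
    exact typeProj_add _ _ _ _
  map_smul' := fun c α => by
    funext x
    change typeProj (j.toField x) p ((c • α.1).extDer x) = _
    rw [CForm.extDer_smul c α.2]
    exact typeProj_smul _ _ _ _

section Cohomology

variable (j : AlmostComplexStructure E M)
  (A : (p q : ℕ) → Submodule ℂ (smoothForms E M (p + q))) (p : ℕ)

/-- The kernel of `∂̄` on a bigraded space `A` of smooth forms. -/
def dbarCocycles (q : ℕ) : Submodule ℂ (smoothForms E M (p + q)) :=
  A p q ⊓ LinearMap.ker (dbar j p q)

/-- The image of `∂̄ : A^{p,q-1} → Ω^{p,q}` (zero for `q = 0`). -/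
def dbarCoboundaries : (q : ℕ) → Submodule ℂ (smoothForms E M (p + q))
  | 0 => ⊥
  | q + 1 => ((A p q).map (dbar j p q)).comap (smoothForms E M (p + (q + 1))).subtype

/-- The cohomology `Ker ∂̄|_{A^{p,q}} / Im ∂̄|_{A^{p,q-1}}`. -/
abbrev DbarCohomology (q : ℕ) : Type _ :=
  dbarCocycles j A p q ⧸ (dbarCoboundaries j A p q).submoduleOf (dbarCocycles j A p q)

variable {j A p} in
/-- The cohomology class of a `∂̄`-closed form. -/
def dbarClass {q : ℕ} {α : smoothForms E M (p + q)} (hα : α ∈ dbarCocycles j A p q) :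
    DbarCohomology j A p q :=
  Submodule.Quotient.mk ⟨α, hα⟩

end Cohomology

/-- The Dolbeault cohomology `H^{p,q}_{j,∂̄}(M)` of a manifold with a complex structure `j`. -/
abbrev DolbeaultCohomology (j : AlmostComplexStructure E M) (p q : ℕ) : Type _ :=
  DbarCohomology j (typeForms j) p q

/-- The `𝒟`-transverse Dolbeault cohomology `H^{p,q}_{𝒟,[j],∂̄}(M)` induced by an almost complex
structure `j` which defines a `𝒟`-transverse complex structure. -/
abbrev TransverseDolbeaultCohomology (𝒟 : Set (VField E M)) (j : AlmostComplexStructure E M)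
    (p q : ℕ) : Type _ :=
  DbarCohomology j (transverseForms 𝒟 j) p q

/-! ### The space of leaves -/

/-- `L` is a connected integral manifold of `D`: the image of a connected manifold under an
injective immersion whose tangent spaces are those of `D`. -/
def TangentDistribution.IsConnectedIntegralManifold (D : TangentDistribution E M) (L : Set M) :
    Prop :=
  ∃ (r : ℕ) (S : Type u) (_ : TopologicalSpace S) (_ : ChartedSpace (EuclideanSpace ℝ (Fin r)) S)
    (f : S → M),
    IsManifold 𝓘(ℝ, EuclideanSpace ℝ (Fin r)) ∞ S ∧ T2Space S ∧ SecondCountableTopology S ∧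
    ConnectedSpace S ∧
    ContMDiff 𝓘(ℝ, EuclideanSpace ℝ (Fin r)) 𝓘(ℝ, E) ∞ f ∧ Function.Injective f ∧
    (∀ s, Function.Injective (mfderiv 𝓘(ℝ, EuclideanSpace ℝ (Fin r)) 𝓘(ℝ, E) f s) ∧
      (mfderiv 𝓘(ℝ, EuclideanSpace ℝ (Fin r)) 𝓘(ℝ, E) f s).toLinearMap.range = D (f s)) ∧
    Set.range f = L

/-- A leaf of `D` is a maximal connected integral manifold. -/
def TangentDistribution.IsLeaf (D : TangentDistribution E M) (L : Set M) : Prop :=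
  D.IsConnectedIntegralManifold L ∧
    ∀ L' : Set M, D.IsConnectedIntegralManifold L' → (L' ∩ L).Nonempty → L' ⊆ L

/-- The space of leaves `M/D`. -/
structure LeafSpace (D : TangentDistribution E M) : Type u where
  /-- the leaf, as a subset of `M` -/
  carrier : Set M
  isLeaf : D.IsLeaf carrier

/-- The pullback of a form by a map. -/
def CForm.pullback {E' : Type*} [NormedAddCommGroup E'] [NormedSpace ℝ E']
    {N : Type*} [TopologicalSpace N] [ChartedSpace E' N] (f : M → N) (β : CForm E' N n) :
    CForm E M n := fun x =>
  (β (f x)).compContinuousLinearMap (mfderiv 𝓘(ℝ, E) 𝓘(ℝ, E') f x)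

end Manifold

end

/-! Everything rests on three facts about the projection `π`: it is surjective, its fibres are
connected, and the kernel of its differential is `D`. The fibres are the leaves, because two leaves
that meet coincide; each is the image of a connected manifold. That `D` lies in the kernel is clear,
since `π` is constant on leaves. Equality (`mfderiv_proj_eq_zero_iff`) is a dimension count: in
submersion charts a leaf covers an open subset of a slice, and a smooth image of a second countable
manifold of dimension `r` has Hausdorff dimension at most `r`.

Transversality of `j`. If `G` intertwines `j` with a matrix valued function `J`, then `dG` of the
Nijenhuis tensor is a first order expression in `J` and the values of `dG` (`vderiv_nijenhuis`). For
`G = ψ ∘ π`, with `ψ` a chart of the leaf space, this is the same expression as for `jhat` and `ψ`,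
where it vanishes. In the same way `dG` of a Lie derivative of `j` along a vertical field is the
derivative of `J` in a vertical direction, and `J` factors through `π`. So both tensors take values
in `ker dπ = D`.

The isomorphism already holds for forms. A pullback is annihilated by contraction and Lie derivative
along vertical fields, and pullback respects types, `d`, hence `∂̄`. Conversely
(`CForm.exists_pullback_eq`), a transverse form sees only the images of its arguments under `dπ`.
Evaluated on fields that are constant in an adapted chart it is locally constant along the fibres,
because such fields commute with constant vertical ones; connectedness of the fibres makes it
descend. The descended form is smooth because locally it is the pullback of the given form by a
smooth section of `π`. Cocycles and coboundaries then correspond.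

For the map to the `j`-transverse cohomology, transversality of `j` and involutivity give `𝒟_j^∞ ⊆
𝒟`, and transversality to more fields is the stronger condition. -/

noncomputable section

/-! ### Derivatives of vector valued functions along Lie brackets. -/

section BracketFormula

variable {E : Type*} [NormedAddCommGroup E] [NormedSpace ℝ E]
  {M : Type*} [TopologicalSpace M] [ChartedSpace E M]
  {W : Type*} [NormedAddCommGroup W] [NormedSpace ℝ W]

/-- The differential at `x` of a vector valued function. -/
def vderiv (f : M → W) (x : M) : TangentSpace 𝓘(ℝ, E) x →L[ℝ] W := mfderiv 𝓘(ℝ, E) 𝓘(ℝ, W) f x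

lemma vderiv_eq_fderiv {f : M → W} {x : M} (hf : MDifferentiableAt 𝓘(ℝ, E) 𝓘(ℝ, W) f x) (v : E) :
    fderiv ℝ (f ∘ (extChartAt 𝓘(ℝ, E) x).symm) (extChartAt 𝓘(ℝ, E) x x) v = vderiv f x v := by
  obtain ⟨A, hA, h⟩ : ∃ A : E →L[ℝ] W, (∀ v : E, A v = vderiv f x v) ∧
      HasFDerivWithinAt (f ∘ (extChartAt 𝓘(ℝ, E) x).symm) A (Set.range 𝓘(ℝ, E))
        (extChartAt 𝓘(ℝ, E) x x) :=
    ⟨vderiv f x, fun _ => rfl, hf.hasMFDerivAt.2⟩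
  rw [modelWithCornersSelf_coe, Set.range_id, hasFDerivWithinAt_univ] at h
  rw [h.fderiv, hA]

variable [IsManifold 𝓘(ℝ, E) ∞ M]

lemma vderiv_comp_symm {f : M → W} {x₀ : M} {y : E}
    (hy : y ∈ (extChartAt 𝓘(ℝ, E) x₀).target)
    (hf : MDifferentiableAt 𝓘(ℝ, E) 𝓘(ℝ, W) f ((extChartAt 𝓘(ℝ, E) x₀).symm y)) :
    fderiv ℝ (f ∘ (extChartAt 𝓘(ℝ, E) x₀).symm) y
      = (vderiv f ((extChartAt 𝓘(ℝ, E) x₀).symm y)).comp (chartSymmDeriv x₀ y) := by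
  have h := mdifferentiableWithinAt_extChartAt_symm (I := 𝓘(ℝ, E)) hy
  rw [modelWithCornersSelf_coe, Set.range_id, mdifferentiableWithinAt_univ] at h
  rw [← mfderiv_eq_fderiv]
  exact mfderiv_comp _ hf h

lemma ContMDiffAt.vderiv_apply {G : M → W} {x : M} {X : (x : M) → TangentSpace 𝓘(ℝ, E) x}
    (hG : ContMDiffAt 𝓘(ℝ, E) 𝓘(ℝ, W) ∞ G x)
    (hX : ContMDiffAt 𝓘(ℝ, E) 𝓘(ℝ, E).tangent ∞ (fun x => (⟨x, X x⟩ : TangentBundle 𝓘(ℝ, E) M)) x) :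
    ContMDiffAt 𝓘(ℝ, E) 𝓘(ℝ, W) ∞ (fun z => vderiv G z (X z)) x := by
  have h := hG.mfderiv_const (m := ∞) le_rfl
  have := ContMDiffAt.clm_apply_of_inCoordinates (b₁ := id) (b₂ := G) h hX hG
  exact (contMDiff_snd_tangentBundle_modelSpace W 𝓘(ℝ, W)).contMDiffAt.comp x this

lemma isInvertible_chartSymmDeriv {x₀ : M} {y : E} (hy : y ∈ (extChartAt 𝓘(ℝ, E) x₀).target) :
    (chartSymmDeriv x₀ y).IsInvertible := by
  have hinv := isInvertible_mfderivWithin_extChartAt_symm (I := 𝓘(ℝ, E)) (M := M) hy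
  rwa [modelWithCornersSelf_coe, Set.range_id, mfderivWithin_univ] at hinv

/-- The differential of a function applied to a Lie bracket. -/
lemma vderiv_mlieBracket [CompleteSpace E] {G : M → W} {x : M} {X Y : (x : M) → TangentSpace 𝓘(ℝ, E) x}
    (hG : ContMDiffAt 𝓘(ℝ, E) 𝓘(ℝ, W) ∞ G x)
    (hX : ContMDiffAt 𝓘(ℝ, E) 𝓘(ℝ, E).tangent ∞ (fun x => (⟨x, X x⟩ : TangentBundle 𝓘(ℝ, E) M)) x)
    (hY : ContMDiffAt 𝓘(ℝ, E) 𝓘(ℝ, E).tangent ∞ (fun x => (⟨x, Y x⟩ : TangentBundle 𝓘(ℝ, E) M)) x) :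
    vderiv G x (VectorField.mlieBracket 𝓘(ℝ, E) X Y x)
      = vderiv (fun z => vderiv G z (Y z)) x (X x) - vderiv (fun z => vderiv G z (X z)) x (Y x) := by
  set φ := extChartAt 𝓘(ℝ, E) x with hφ
  -- `L X` is the expression of `X` in the chart at `x`.
  let L : ((x : M) → TangentSpace 𝓘(ℝ, E) x) → E → E :=
    fun X y => (chartSymmDeriv x y).inverse (X (φ.symm y))
  have hL : ∀ X : (x : M) → TangentSpace 𝓘(ℝ, E) x,
      VectorField.mpullbackWithin 𝓘(ℝ, E) 𝓘(ℝ, E) φ.symm X Set.univ = L X := by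
    intro X; funext y
    rw [VectorField.mpullbackWithin_apply, mfderivWithin_univ]; rfl
  have hφx : φ.symm (φ x) = x := extChartAt_to_inv x
  have htgt : φ.target ∈ 𝓝 (φ x) := (isOpen_extChartAt_target x).mem_nhds (mem_extChartAt_target x)
  have hLd : ∀ {X : (x : M) → TangentSpace 𝓘(ℝ, E) x},
      ContMDiffAt 𝓘(ℝ, E) 𝓘(ℝ, E).tangent ∞ (fun x => (⟨x, X x⟩ : TangentBundle 𝓘(ℝ, E) M)) x →
      DifferentiableAt ℝ (L X) (φ x) := by
    intro X hX
    have h := MDifferentiableWithinAt.differentiableWithinAt_mpullbackWithin_vectorField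
      (s := Set.univ) (hX.mdifferentiableAt (by simp)).mdifferentiableWithinAt
    rw [modelWithCornersSelf_coe, Set.range_id, Set.preimage_univ, Set.univ_inter] at h
    exact hL X ▸ differentiableWithinAt_univ.mp h
  have hsymm : ContMDiffAt 𝓘(ℝ, E) 𝓘(ℝ, E) ∞ φ.symm (φ x) :=
    ((contMDiffOn_extChartAt_symm x).contMDiffAt htgt)
  have hGt : ContDiffAt ℝ ∞ (G ∘ φ.symm) (φ x) := by
    rw [← contMDiffAt_iff_contDiffAt]
    exact ContMDiffAt.comp _ (by rw [hφx]; exact hG) hsymm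
  have hev : ∀ᶠ y in 𝓝 (φ x), y ∈ φ.target ∧ MDifferentiableAt 𝓘(ℝ, E) 𝓘(ℝ, W) G (φ.symm y) := by
    refine Filter.Eventually.and htgt ?_
    have h1 : ∀ᶠ z in 𝓝 x, MDifferentiableAt 𝓘(ℝ, E) 𝓘(ℝ, W) G z := by
      have : ContMDiffAt 𝓘(ℝ, E) 𝓘(ℝ, W) 1 G x := hG.of_le (by exact_mod_cast le_top)
      filter_upwards [contMDiffAt_iff_contMDiffAt_nhds (by simp) |>.1 this] with z hz
      exact hz.mdifferentiableAt (by simp)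
    exact hsymm.continuousAt.eventually (by rwa [hφx])
  have happ : ∀ X : (x : M) → TangentSpace 𝓘(ℝ, E) x,
      (fun y => fderiv ℝ (G ∘ φ.symm) y (L X y)) =ᶠ[𝓝 (φ x)]
        (fun z => vderiv G z (X z)) ∘ φ.symm := by
    intro X
    filter_upwards [hev] with y hy
    rw [vderiv_comp_symm hy.1 hy.2]
    exact congrArg (vderiv G (φ.symm y)) ((isInvertible_chartSymmDeriv hy.1).self_apply_inverse _)
  have hder : ∀ {X Y : (x : M) → TangentSpace 𝓘(ℝ, E) x},
      ContMDiffAt 𝓘(ℝ, E) 𝓘(ℝ, E).tangent ∞ (fun x => (⟨x, Y x⟩ : TangentBundle 𝓘(ℝ, E) M)) x →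
      fderiv ℝ (fun y => fderiv ℝ (G ∘ φ.symm) y (L Y y)) (φ x) (L X (φ x))
        = vderiv (fun z => vderiv G z (Y z)) x (X x) := by
    intro X Y hY
    rw [(happ Y).fderiv_eq, vderiv_comp_symm (mem_extChartAt_target x)
      (by rw [← hφ, hφx]; exact (hG.vderiv_apply hY).mdifferentiableAt (by simp))]
    have := (isInvertible_chartSymmDeriv (mem_extChartAt_target x)).self_apply_inverse
      (X (φ.symm (φ x)))
    refine (congrArg (vderiv (fun z => vderiv G z (Y z)) (φ.symm (φ x))) this).trans ?_
    rw [hφx]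
  -- The bracket at `x` is defined by pulling back the Euclidean bracket along the preferred chart,
  -- whose derivative at its own base point is the identity of `E`.
  have hbr : (VectorField.mlieBracket 𝓘(ℝ, E) X Y x : E)
      = VectorField.lieBracket ℝ (L X) (L Y) (φ x) := by
    have hinv : ∀ w : E, ((mfderiv 𝓘(ℝ, E) 𝓘(ℝ, E) φ x).inverse w : E) = w := fun w =>
      (congrArg (fun A : E →L[ℝ] E => A.inverse w) mfderiv_extChartAt_self).trans
        (DFunLike.congr_fun (ContinuousLinearMap.inverse_id (R := ℝ) (M := E)) w)
    rw [← VectorField.mlieBracketWithin_univ, VectorField.mlieBracketWithin_apply]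
    refine (hinv _).trans ?_
    simp only [modelWithCornersSelf_coe, Set.range_id, Set.preimage_univ, Set.univ_inter]
    rw [hL, hL]
    exact congrFun (VectorField.lieBracketWithin_univ (𝕜 := ℝ) (V := L X) (W := L Y)) _
  have h2 : minSmoothness ℝ 2 ≤ ∞ := by
    simpa [minSmoothness_of_isRCLikeNormedField] using ENat.LEInfty.out
  -- The Euclidean identity, which is the symmetry of the second derivative of `G` in the chart.
  have h := VectorField.fderiv_apply_lieBracket hGt h2 (hLd hY) (hLd hX)
  rw [hder hY, hder hX] at h
  refine Eq.trans ?_ h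
  rw [vderiv_eq_fderiv (hG.mdifferentiableAt (by simp))]
  exact congrArg (fun w : E => (vderiv G x w : W)) hbr

end BracketFormula

/-! ### Chain and product rules for `vderiv`. -/

section Calculus

variable {E : Type*} [NormedAddCommGroup E] [NormedSpace ℝ E]
  {M : Type*} [TopologicalSpace M] [ChartedSpace E M]
  {E' : Type*} [NormedAddCommGroup E'] [NormedSpace ℝ E']
  {N : Type*} [TopologicalSpace N] [ChartedSpace E' N]
  {W : Type*} [NormedAddCommGroup W] [NormedSpace ℝ W]
  {W' : Type*} [NormedAddCommGroup W'] [NormedSpace ℝ W']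

lemma vderiv_comp {f : N → W} {g : M → N} {x : M}
    (hf : MDifferentiableAt 𝓘(ℝ, E') 𝓘(ℝ, W) f (g x))
    (hg : MDifferentiableAt 𝓘(ℝ, E) 𝓘(ℝ, E') g x) (v : TangentSpace 𝓘(ℝ, E) x) :
    vderiv (f ∘ g) x v = vderiv f (g x) (mfderiv 𝓘(ℝ, E) 𝓘(ℝ, E') g x v) :=
  DFunLike.congr_fun (mfderiv_comp x hf hg) v

lemma Filter.EventuallyEq.vderiv_eq {f g : M → W} {x : M} (h : f =ᶠ[𝓝 x] g)
    (v : TangentSpace 𝓘(ℝ, E) x) : vderiv f x v = vderiv g x v := by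
  have : vderiv (E := E) f x = vderiv g x := Filter.EventuallyEq.mfderiv_eq h
  rw [this]

lemma vderiv_const (c : W) (x : M) (v : TangentSpace 𝓘(ℝ, E) x) :
    vderiv (fun _ : M => c) x v = 0 := by
  have : vderiv (E := E) (fun _ : M => c) x = 0 := mfderiv_const
  rw [this]; rfl

lemma MDifferentiableAt.differentiableAt_comp_symm {f : M → W} {x : M}
    (hf : MDifferentiableAt 𝓘(ℝ, E) 𝓘(ℝ, W) f x) :
    DifferentiableAt ℝ (f ∘ (extChartAt 𝓘(ℝ, E) x).symm) (extChartAt 𝓘(ℝ, E) x x) := by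
  have := hf.differentiableWithinAt_writtenInExtChartAt
  rwa [modelWithCornersSelf_coe, Set.range_id, differentiableWithinAt_univ] at this

lemma vderiv_clm_apply {A : M → W →L[ℝ] W'} {w : M → W} {x : M}
    (hA : MDifferentiableAt 𝓘(ℝ, E) 𝓘(ℝ, W →L[ℝ] W') A x)
    (hw : MDifferentiableAt 𝓘(ℝ, E) 𝓘(ℝ, W) w x) (v : TangentSpace 𝓘(ℝ, E) x) :
    vderiv (fun z => A z (w z)) x v = vderiv A x v (w x) + A x (vderiv w x v) := by
  have hv : ∃ v' : E, v' = v := ⟨v, rfl⟩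
  obtain ⟨v', rfl⟩ := hv
  have hφ : MDifferentiableAt 𝓘(ℝ, E) 𝓘(ℝ, W') (fun z => A z (w z)) x := hA.clm_apply hw
  rw [← vderiv_eq_fderiv hφ, ← vderiv_eq_fderiv hA, ← vderiv_eq_fderiv hw]
  have := fderiv_clm_apply hA.differentiableAt_comp_symm hw.differentiableAt_comp_symm
  refine (DFunLike.congr_fun this v').trans ?_
  simp [add_comm]

end Calculus

/-! ### Smooth fields; Nijenhuis tensor and Lie derivative seen through an intertwining map. -/

section Fields

variable {E : Type*} [NormedAddCommGroup E] [NormedSpace ℝ E]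
  {M : Type*} [TopologicalSpace M] [ChartedSpace E M] [IsManifold 𝓘(ℝ, E) ∞ M]
  {W : Type*} [NormedAddCommGroup W] [NormedSpace ℝ W]

lemma VField.Smooth.bracket [CompleteSpace E] {X Y : VField E M} (hX : X.Smooth) (hY : Y.Smooth) :
    (X.bracket Y).Smooth := fun x =>
  have : IsManifold 𝓘(ℝ, E) (minSmoothness ℝ 2) M := by
    rw [minSmoothness_of_isRCLikeNormedField]; infer_instance
  have : IsManifold 𝓘(ℝ, E) ((⊤ : ℕ∞) + 1) M := by
    simpa using (inferInstance : IsManifold 𝓘(ℝ, E) ∞ M)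
  ContMDiffAt.mlieBracket_vectorField (m := ⊤) (n := ⊤) (hX x) (hY x)
    (by simp [minSmoothness_of_isRCLikeNormedField])

lemma EndField.Smooth.app {k : EndField E M} (hk : k.Smooth) {X : VField E M} (hX : X.Smooth) :
    (k.app X).Smooth := fun x => ContMDiffAt.clm_bundle_apply (b := id) (hk x) (hX x)

lemma VField.Smooth.add {X Y : VField E M} (hX : X.Smooth) (hY : Y.Smooth) : (X + Y).Smooth :=
  ContMDiff.add_section hX hY

lemma VField.Smooth.sub {X Y : VField E M} (hX : X.Smooth) (hY : Y.Smooth) : (X - Y).Smooth :=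
  ContMDiff.sub_section hX hY

lemma VField.smooth_zero : (0 : VField E M).Smooth := Bundle.contMDiff_zeroSection ℝ _

lemma EndField.Smooth.nijenhuis [CompleteSpace E] {k : EndField E M} (hk : k.Smooth)
    {X Y : VField E M} (hX : X.Smooth) (hY : Y.Smooth) : (k.nijenhuis X Y).Smooth :=
  ((((hk.app hX).bracket (hk.app hY)).sub (hk.app ((hk.app hX).bracket hY))).sub
    (hk.app (hX.bracket (hk.app hY)))).add (hk.app (hk.app (hX.bracket hY)))

lemma EndField.Smooth.lieDeriv [CompleteSpace E] {k : EndField E M} (hk : k.Smooth)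
    {F U : VField E M} (hF : F.Smooth) (hU : U.Smooth) : (k.lieDeriv F U).Smooth :=
  (hF.bracket (hk.app hU)).sub (hk.app (hF.bracket hU))

/-- The expression of a field of endomorphisms in the preferred chart at `y₀`. -/
def EndField.inCoord (k : EndField E M) (y₀ y : M) : E →L[ℝ] E :=
  ContinuousLinearMap.inCoordinates E (TangentSpace 𝓘(ℝ, E)) E (TangentSpace 𝓘(ℝ, E)) y₀ y y₀ y (k y)

lemma EndField.Smooth.inCoord {k : EndField E M} (hk : k.Smooth) (y : M) :
    ContMDiffAt 𝓘(ℝ, E) 𝓘(ℝ, E →L[ℝ] E) ∞ (k.inCoord y) y :=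
  ((contMDiffAt_hom_bundle _).1 (hk y)).2

/-- On the chart domain the differential of the chart is the trivialization of the tangent bundle
that defines `inCoord`. This supplies the matrix function `J` needed by `vderiv_nijenhuis` and
`vderiv_lieDeriv`. -/
lemma EndField.vderiv_extChartAt_apply (k : EndField E M) {y₀ y : M}
    (hy : y ∈ (chartAt E y₀).source) (v : TangentSpace 𝓘(ℝ, E) y) :
    vderiv (extChartAt 𝓘(ℝ, E) y₀) y (k y v)
      = k.inCoord y₀ y (vderiv (extChartAt 𝓘(ℝ, E) y₀) y v) := by
  have h : ∀ w, vderiv (extChartAt 𝓘(ℝ, E) y₀) y w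
      = (trivializationAt E (TangentSpace 𝓘(ℝ, E)) y₀).continuousLinearMapAt ℝ y w := fun w =>
    (DFunLike.congr_fun (TangentBundle.continuousLinearMapAt_trivializationAt hy) w).symm
  have hb : y ∈ (trivializationAt E (TangentSpace 𝓘(ℝ, E)) y₀).baseSet := by
    rwa [TangentBundle.trivializationAt_baseSet]
  rw [h, h]
  exact congrArg (fun w => (trivializationAt E (TangentSpace 𝓘(ℝ, E)) y₀).continuousLinearMapAt ℝ y
    (k y w)) (Bundle.Trivialization.symmL_continuousLinearMapAt (R := ℝ)
      (trivializationAt E (TangentSpace 𝓘(ℝ, E)) y₀) hb v).symm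

variable {k : EndField E M} {G : M → W} {J : M → W →L[ℝ] W} {x : M}

/-- Expand each bracket with `vderiv_mlieBracket` and each `dG(kZ) = J dG(Z)` with the product rule.
All derivatives of `dG(X)` and `dG(Y)` cancel, without using `J² = -1`. What remains depends only on
`J`, its derivative, and the values of the fields at `x`, so it can be compared between `M` and the
leaf space without lifting vector fields. -/
lemma vderiv_nijenhuis [CompleteSpace E] (hk : k.Smooth)
    (hG : ContMDiffAt 𝓘(ℝ, E) 𝓘(ℝ, W) ∞ G x)
    (hJ : MDifferentiableAt 𝓘(ℝ, E) 𝓘(ℝ, W →L[ℝ] W) J x)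
    (h : ∀ᶠ z in 𝓝 x, ∀ v : TangentSpace 𝓘(ℝ, E) z, vderiv G z (k z v) = J z (vderiv G z v))
    {X Y : VField E M} (hX : X.Smooth) (hY : Y.Smooth) :
    vderiv G x (k.nijenhuis X Y x) =
      vderiv J x (k x (X x)) (vderiv G x (Y x)) - vderiv J x (k x (Y x)) (vderiv G x (X x))
        + J x (vderiv J x (Y x) (vderiv G x (X x))) - J x (vderiv J x (X x) (vderiv G x (Y x))) := by
  have hP : ∀ {Z : VField E M}, Z.Smooth →
      MDifferentiableAt 𝓘(ℝ, E) 𝓘(ℝ, W) (fun z => vderiv G z (Z z)) x := fun hZ =>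
    (hG.vderiv_apply (hZ x)).mdifferentiableAt (by simp)
  have hx := h.self_of_nhds
  have hD : ∀ {Z : VField E M}, Z.Smooth → ∀ v : TangentSpace 𝓘(ℝ, E) x,
      vderiv (fun z => vderiv G z (k.app Z z)) x v
        = vderiv J x v (vderiv G x (Z x)) + J x (vderiv (fun z => vderiv G z (Z z)) x v) := by
    intro Z hZ v
    rw [← vderiv_clm_apply hJ (hP hZ)]
    refine Filter.EventuallyEq.vderiv_eq (E := E) ?_ v
    filter_upwards [h] with z hz using hz _
  have hB : ∀ {Z Z' : VField E M}, Z.Smooth → Z'.Smooth → vderiv G x (Z.bracket Z' x)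
      = vderiv (fun z => vderiv G z (Z' z)) x (Z x) - vderiv (fun z => vderiv G z (Z z)) x (Z' x) :=
    fun hZ hZ' => vderiv_mlieBracket hG (hZ x) (hZ' x)
  have e : vderiv G x (k.nijenhuis X Y x) = vderiv G x ((k.app X).bracket (k.app Y) x)
      - vderiv G x (k x ((k.app X).bracket Y x)) - vderiv G x (k x (X.bracket (k.app Y) x))
      + vderiv G x (k x (k x (X.bracket Y x))) := by
    simp only [EndField.nijenhuis, Pi.add_apply, Pi.sub_apply, map_add, map_sub, EndField.app]
  rw [e, hx, hx, hx, hx, hB (hk.app hX) (hk.app hY), hB (hk.app hX) hY, hB hX (hk.app hY), hB hX hY]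
  simp only [hD hX, hD hY]
  simp only [map_add, map_sub, EndField.app]
  abel

/-- Since `dG(F) = 0` near `x`, `dG[F, Z]` is the derivative of `dG(Z)` along `F`. The product rule
applied to `J dG(U)` then leaves the derivative of `J`. -/
lemma vderiv_lieDeriv [CompleteSpace E] (hk : k.Smooth)
    (hG : ContMDiffAt 𝓘(ℝ, E) 𝓘(ℝ, W) ∞ G x)
    (hJ : MDifferentiableAt 𝓘(ℝ, E) 𝓘(ℝ, W →L[ℝ] W) J x)
    (h : ∀ᶠ z in 𝓝 x, ∀ v : TangentSpace 𝓘(ℝ, E) z, vderiv G z (k z v) = J z (vderiv G z v))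
    {F U : VField E M} (hF : F.Smooth) (hU : U.Smooth) (hFG : ∀ᶠ z in 𝓝 x, vderiv G z (F z) = 0) :
    vderiv G x (k.lieDeriv F U x) = vderiv J x (F x) (vderiv G x (U x)) := by
  have hx := h.self_of_nhds
  have hP : MDifferentiableAt 𝓘(ℝ, E) 𝓘(ℝ, W) (fun z => vderiv G z (U z)) x :=
    (hG.vderiv_apply (hU x)).mdifferentiableAt (by simp)
  have hF0 : ∀ v : TangentSpace 𝓘(ℝ, E) x, vderiv (fun z => vderiv G z (F z)) x v = 0 := fun v =>
    (Filter.EventuallyEq.vderiv_eq (E := E) hFG v).trans (vderiv_const 0 x v)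
  have hD : vderiv (fun z => vderiv G z (k.app U z)) x (F x)
        = vderiv J x (F x) (vderiv G x (U x)) + J x (vderiv (fun z => vderiv G z (U z)) x (F x)) := by
    rw [← vderiv_clm_apply hJ hP]
    refine Filter.EventuallyEq.vderiv_eq (E := E) ?_ _
    filter_upwards [h] with z hz using hz _
  have e : vderiv G x (k.lieDeriv F U x) = vderiv G x (F.bracket (k.app U) x)
      - vderiv G x (k x (F.bracket U x)) := by
    simp only [EndField.lieDeriv, Pi.sub_apply, map_sub, EndField.app]
  rw [e, hx, VField.bracket, VField.bracket, vderiv_mlieBracket hG (hF x) ((hk.app hU) x),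
    vderiv_mlieBracket hG (hF x) (hU x), hD, hF0, hF0]
  simp

end Fields

/-! ### Fields constant in a chart, and their extension to global smooth fields. -/

section ChartFields

variable {E : Type*} [NormedAddCommGroup E] [NormedSpace ℝ E]
  {M : Type*} [TopologicalSpace M] [ChartedSpace E M]

lemma OpenPartialHomeomorph.mdifferentiable_of_mem_maximalAtlas
    {φ : OpenPartialHomeomorph M E} (hφ : φ ∈ IsManifold.maximalAtlas 𝓘(ℝ, E) ∞ M) :
    φ.MDifferentiable 𝓘(ℝ, E) 𝓘(ℝ, E) :=
  ⟨(contMDiffOn_of_mem_maximalAtlas hφ).mdifferentiableOn (by simp),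
    (contMDiffOn_symm_of_mem_maximalAtlas hφ).mdifferentiableOn (by simp)⟩

lemma vderiv_chart_bijective {φ : OpenPartialHomeomorph M E}
    (hφ : φ ∈ IsManifold.maximalAtlas 𝓘(ℝ, E) ∞ M) {z : M} (hz : z ∈ φ.source) :
    Function.Bijective (vderiv (E := E) φ z) :=
  (OpenPartialHomeomorph.mdifferentiable_of_mem_maximalAtlas hφ).mfderiv_bijective hz

lemma isInvertible_mfderiv_chart {φ : OpenPartialHomeomorph M E}
    (hφ : φ ∈ IsManifold.maximalAtlas 𝓘(ℝ, E) ∞ M) {z : M} (hz : z ∈ φ.source) :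
    (mfderiv 𝓘(ℝ, E) 𝓘(ℝ, E) φ z).IsInvertible :=
  have h := OpenPartialHomeomorph.mdifferentiable_of_mem_maximalAtlas hφ
  have key : ∀ y ∈ φ.target, (mfderiv 𝓘(ℝ, E) 𝓘(ℝ, E) φ (φ.symm y)).IsInvertible := fun y hy => by
    have h1 := h.symm_comp_deriv (φ.map_target hy)
    rw [φ.right_inv hy] at h1
    exact ContinuousLinearMap.IsInvertible.of_inverse (h.comp_symm_deriv hy) h1
  φ.left_inv hz ▸ key (φ z) (φ.map_source hz)

/-- The vector field which is constant equal to `c` in the chart `φ`. -/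
def chartField (φ : OpenPartialHomeomorph M E) (c : E) : VField E M :=
  VectorField.mpullback 𝓘(ℝ, E) 𝓘(ℝ, E) φ fun _ => c

lemma vderiv_chartField {φ : OpenPartialHomeomorph M E}
    (hφ : φ ∈ IsManifold.maximalAtlas 𝓘(ℝ, E) ∞ M) (c : E) {z : M} (hz : z ∈ φ.source) :
    vderiv φ z (chartField φ c z) = c :=
  (isInvertible_mfderiv_chart hφ hz).self_apply_inverse _

variable [IsManifold 𝓘(ℝ, E) ∞ M]

lemma chartField_smoothOn [CompleteSpace E] {φ : OpenPartialHomeomorph M E}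
    (hφ : φ ∈ IsManifold.maximalAtlas 𝓘(ℝ, E) ∞ M) (c : E) :
    (chartField φ c).SmoothOn φ.source := fun z hz =>
  (ContMDiffAt.mpullback_vectorField_preimage (n := ∞) (m := ∞)
    (contMDiffAt_vectorSpace_iff_contDiffAt.2 contDiffAt_const)
    (contMDiffAt_of_mem_maximalAtlas hφ hz) (isInvertible_mfderiv_chart hφ hz)
      (by simp)).contMDiffWithinAt

/-- Multiply by a bump function. The last two clauses ensure that the cut-off field stays in any
distribution containing `V` on `U`. -/
lemma VField.exists_smooth_eventuallyEq [FiniteDimensional ℝ E] [T2Space M] {V : VField E M}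
    {U : Set M} (hU : IsOpen U) (hV : V.SmoothOn U) {x : M} (hx : x ∈ U) :
    ∃ X : VField E M, X.Smooth ∧ X =ᶠ[𝓝 x] V ∧ (∀ z ∈ U, ∃ c : ℝ, X z = c • V z) ∧
      ∀ z ∉ U, X z = 0 := by
  obtain ⟨ρ, -, hρ⟩ := (SmoothBumpFunction.nhds_basis_tsupport (I := 𝓘(ℝ, E)) x).mem_iff.1
    (hU.mem_nhds hx)
  refine ⟨fun z => ρ z • V z, ?_, ?_, fun z _ => ⟨ρ z, rfl⟩, fun z hz => ?_⟩
  · exact ContMDiffOn.smul_section_of_tsupport ρ.contMDiff.contMDiffOn hU hρ hV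
  · filter_upwards [ρ.eventuallyEq_one] with z hz
    change ρ z • V z = V z
    rw [hz]
    exact one_smul ℝ _
  · simp [image_eq_zero_of_notMem_tsupport fun h => hz (hρ h)]

lemma VField.exists_smooth_eq [FiniteDimensional ℝ E] [T2Space M] (x : M)
    (v : TangentSpace 𝓘(ℝ, E) x) : ∃ X : VField E M, X.Smooth ∧ X x = v := by
  have hφ := IsManifold.chart_mem_maximalAtlas (I := 𝓘(ℝ, E)) (n := ∞) x
  have := FiniteDimensional.complete ℝ E
  obtain ⟨X, hX, h, -⟩ := VField.exists_smooth_eventuallyEq (chartAt E x).open_source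
    (chartField_smoothOn hφ (vderiv (chartAt E x) x v)) (mem_chart_source E x)
  refine ⟨X, hX, (vderiv_chart_bijective hφ (mem_chart_source E x)).1 ?_⟩
  rw [h.self_of_nhds, vderiv_chartField hφ _ (mem_chart_source E x)]

end ChartFields

/-! ### Adapted charts of a submersion. -/

section Submersion

variable {E : Type*} [NormedAddCommGroup E] [NormedSpace ℝ E]
  {M : Type*} [TopologicalSpace M] [ChartedSpace E M]
  {E' : Type*} [NormedAddCommGroup E'] [NormedSpace ℝ E']
  {N : Type*} [TopologicalSpace N] [ChartedSpace E' N]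
  {F : Type*} [NormedAddCommGroup F] [NormedSpace ℝ F]

/-- Charts `φ`, `ψ` in which `π` is the linear projection `fst ∘ e`. -/
structure IsProjectionInCharts (π : M → N) (φ : OpenPartialHomeomorph M E)
    (ψ : OpenPartialHomeomorph N E') (e : E ≃L[ℝ] E' × F) : Prop where
  dom_mem : φ ∈ IsManifold.maximalAtlas 𝓘(ℝ, E) ∞ M
  cod_mem : ψ ∈ IsManifold.maximalAtlas 𝓘(ℝ, E') ∞ N
  mapsTo : ∀ z ∈ φ.source, π z ∈ ψ.source
  apply_eq : ∀ z ∈ φ.source, ψ (π z) = (e (φ z)).1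

lemma Manifold.IsSubmersion.exists_charts {E : Type u} [NormedAddCommGroup E] [NormedSpace ℝ E]
    {M : Type*} [TopologicalSpace M] [ChartedSpace E M] {π : M → N}
    (hπ : Manifold.IsSubmersion 𝓘(ℝ, E) 𝓘(ℝ, E') ∞ π) (x : M) :
    ∃ (F : Type u) (_ : NormedAddCommGroup F) (_ : NormedSpace ℝ F)
      (φ : OpenPartialHomeomorph M E) (ψ : OpenPartialHomeomorph N E') (e : E ≃L[ℝ] E' × F),
      x ∈ φ.source ∧ IsProjectionInCharts π φ ψ e := by
  obtain ⟨F, _, _, h⟩ := hπ.isSubmersionAt x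
  refine ⟨F, _, _, h.domChart, h.codChart, h.equiv, h.mem_domChart_source,
    h.domChart_mem_maximalAtlas, h.codChart_mem_maximalAtlas, h.mapsto_domChart_source_codChart_source,
    ?_⟩
  intro z hz
  have hmem : h.domChart z ∈ (h.domChart.extend 𝓘(ℝ, E)).target := by simp [hz]
  simpa [hz] using h.writtenInCharts hmem

namespace IsProjectionInCharts

variable {π : M → N} {φ : OpenPartialHomeomorph M E} {ψ : OpenPartialHomeomorph N E'}
  {e : E ≃L[ℝ] E' × F} (h : IsProjectionInCharts π φ ψ e)
include h

lemma vderiv_apply {z : M} (hz : z ∈ φ.source)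
    (hπ : MDifferentiableAt 𝓘(ℝ, E) 𝓘(ℝ, E') π z) (v : TangentSpace 𝓘(ℝ, E) z) :
    vderiv ψ (π z) (mfderiv 𝓘(ℝ, E) 𝓘(ℝ, E') π z v) = (e (vderiv φ z v)).1 := by
  have hψ : MDifferentiableAt 𝓘(ℝ, E') 𝓘(ℝ, E') ψ (π z) :=
    (contMDiffAt_of_mem_maximalAtlas h.cod_mem (h.mapsTo z hz)).mdifferentiableAt (by simp)
  have hφ : MDifferentiableAt 𝓘(ℝ, E) 𝓘(ℝ, E) φ z :=
    (contMDiffAt_of_mem_maximalAtlas h.dom_mem hz).mdifferentiableAt (by simp)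
  rw [← vderiv_comp hψ hπ]
  have h1 : ψ ∘ π =ᶠ[𝓝 z] (fun y => (e y).1) ∘ φ := by
    filter_upwards [φ.open_source.mem_nhds hz] with y hy using h.apply_eq y hy
  have h2 : DifferentiableAt ℝ (fun y => (e y).1) (φ z) := by fun_prop
  rw [Filter.EventuallyEq.vderiv_eq (E := E) h1, vderiv_comp h2.mdifferentiableAt hφ]
  let A : E →L[ℝ] E' := (ContinuousLinearMap.fst ℝ E' F).comp (e : E →L[ℝ] E' × F)
  have h3 : fderiv ℝ (fun y => (e y).1) (φ z) = A := A.fderiv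
  exact (DFunLike.congr_fun mfderiv_eq_fderiv _).trans (DFunLike.congr_fun h3 _)

lemma mfderiv_surjective {z : M} (hz : z ∈ φ.source)
    (hπ : MDifferentiableAt 𝓘(ℝ, E) 𝓘(ℝ, E') π z) :
    Function.Surjective (mfderiv 𝓘(ℝ, E) 𝓘(ℝ, E') π z) := fun w => by
  obtain ⟨v, hv⟩ := (vderiv_chart_bijective h.dom_mem hz).2 (e.symm (vderiv ψ (π z) w, 0))
  refine ⟨v, (vderiv_chart_bijective h.cod_mem (h.mapsTo z hz)).1 ?_⟩
  rw [h.vderiv_apply hz hπ, hv, e.apply_symm_apply]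

lemma mfderiv_eq_zero_iff {z : M} (hz : z ∈ φ.source)
    (hπ : MDifferentiableAt 𝓘(ℝ, E) 𝓘(ℝ, E') π z) (v : TangentSpace 𝓘(ℝ, E) z) :
    mfderiv 𝓘(ℝ, E) 𝓘(ℝ, E') π z v = 0 ↔ (e (vderiv φ z v)).1 = 0 := by
  rw [← h.vderiv_apply hz hπ, ← map_eq_zero_iff _ (vderiv_chart_bijective h.cod_mem (h.mapsTo z hz)).1]

end IsProjectionInCharts
end Submersion

/-! ### Hausdorff dimension of smooth images. -/

section Dimension

/-- In a chart `g` is locally Lipschitz, and Lipschitz maps do not raise Hausdorff dimension. Second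
countability leaves countably many pieces, over which the dimension of a union is a supremum. -/
lemma dimH_image_le_of_contMDiffOn {H : Type*} [NormedAddCommGroup H] [NormedSpace ℝ H]
    [FiniteDimensional ℝ H] {S : Type*} [TopologicalSpace S] [ChartedSpace H S]
    [SecondCountableTopology S] {F : Type*} [NormedAddCommGroup F] [NormedSpace ℝ F]
    {T : Set S} (hT : IsOpen T) {g : S → F} (hg : ContMDiffOn 𝓘(ℝ, H) 𝓘(ℝ, F) ∞ g T) :
    dimH (g '' T) ≤ Module.finrank ℝ H := by
  have hloc : ∀ s : S, ∃ U : Set S, s ∈ T → U ∈ 𝓝[T] s ∧ dimH (g '' U) ≤ Module.finrank ℝ H := by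
    intro s
    by_cases hs : s ∈ T
    · have h := (contMDiffAt_iff.1 (hg.contMDiffAt (hT.mem_nhds hs))).2
      rw [modelWithCornersSelf_coe, Set.range_id, contDiffWithinAt_univ] at h
      obtain ⟨K, V, hV, hK⟩ := (h.of_le (m := 1) (by exact_mod_cast le_top)).exists_lipschitzOnWith
      refine ⟨(chartAt H s).source ∩ extChartAt 𝓘(ℝ, H) s ⁻¹' V, fun _ => ⟨mem_nhdsWithin_of_mem_nhds
        (Filter.inter_mem ((chartAt H s).open_source.mem_nhds (mem_chart_source H s))
        ((continuousAt_extChartAt s).preimage_mem_nhds hV)), ?_⟩⟩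
      calc dimH (g '' _)
          ≤ dimH ((extChartAt 𝓘(ℝ, F) (g s) ∘ g ∘ (extChartAt 𝓘(ℝ, H) s).symm) '' V) := by
            refine dimH_mono ?_
            rintro _ ⟨t, ⟨ht, htV⟩, rfl⟩
            refine ⟨extChartAt 𝓘(ℝ, H) s t, htV, ?_⟩
            have : (extChartAt 𝓘(ℝ, H) s).symm (extChartAt 𝓘(ℝ, H) s t) = t :=
              (extChartAt 𝓘(ℝ, H) s).left_inv (by simpa using ht)
            simp only [Function.comp_apply, this]
            rfl
        _ ≤ dimH V := hK.dimH_image_le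
        _ ≤ dimH (Set.univ : Set H) := dimH_mono (Set.subset_univ _)
        _ = _ := Real.dimH_univ_eq_finrank H
    · exact ⟨∅, fun h => absurd h hs⟩
  choose U hU using hloc
  obtain ⟨t, htT, ht, hcov⟩ := TopologicalSpace.countable_cover_nhdsWithin fun s hs => (hU s hs).1
  calc dimH (g '' T) ≤ dimH (⋃ s ∈ t, g '' U s) := by
        refine dimH_mono ?_
        rw [← Set.image_iUnion₂]
        exact Set.image_mono hcov
    _ = ⨆ s ∈ t, dimH (g '' U s) := dimH_bUnion ht _
    _ ≤ _ := iSup₂_le fun s hs => (hU s (htT hs)).2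

end Dimension

/-! ### Leaves as fibres, and the kernel of the differential of the projection. -/

section Leaves

variable {E : Type*} [NormedAddCommGroup E] [NormedSpace ℝ E]
  {M : Type u} [TopologicalSpace M] [ChartedSpace E M]
  {D : TangentDistribution E M}

/-- By maximality each of two leaves that meet contains the other. This makes the fibres of `π`
exactly the leaves. -/
lemma LeafSpace.eq_of_mem {L L' : LeafSpace D} {x : M} (h : x ∈ L.carrier) (h' : x ∈ L'.carrier) :
    L = L' := by
  have : L.carrier = L'.carrier :=
    Set.Subset.antisymm (L'.isLeaf.2 _ L.isLeaf.1 ⟨x, h, h'⟩) (L.isLeaf.2 _ L'.isLeaf.1 ⟨x, h', h⟩)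
  cases L; cases L'; congr

lemma LeafSpace.carrier_nonempty (L : LeafSpace D) : L.carrier.Nonempty := by
  obtain ⟨r, S, _, _, f, _, _, _, _, _, _, _, hf⟩ := L.isLeaf.1
  exact hf ▸ Set.range_nonempty f

variable {π : M → LeafSpace D} (hπ : ∀ x, x ∈ (π x).carrier)
include hπ

lemma LeafSpace.mem_carrier_iff {x : M} {L : LeafSpace D} : x ∈ L.carrier ↔ π x = L :=
  ⟨fun h => LeafSpace.eq_of_mem (hπ x) h, fun h => h ▸ hπ x⟩

lemma LeafSpace.proj_surjective : Function.Surjective π := fun L =>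
  L.carrier_nonempty.imp fun _ hx => (LeafSpace.mem_carrier_iff hπ).1 hx

variable {E' : Type*} [NormedAddCommGroup E'] [NormedSpace ℝ E']
  [TopologicalSpace (LeafSpace D)] [ChartedSpace E' (LeafSpace D)]

/-- With the leaf through `x` parametrized by `f : S → M`, `π ∘ f` is constant, so `D ≤ ker dπ`. The
kernel has the dimension of the factor `F` of the submersion chart, and `D` has dimension `r = dim
S`; it remains to see `dim F ≤ r`. This could fail only if the leaf were too small to fill the
fibre, which is excluded by Hausdorff dimension. -/
lemma mfderiv_proj_eq_zero_iff [FiniteDimensional ℝ E]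
    (hsub : Manifold.IsSubmersion 𝓘(ℝ, E) 𝓘(ℝ, E') ∞ π)
    (x : M) (v : TangentSpace 𝓘(ℝ, E) x) : mfderiv 𝓘(ℝ, E) 𝓘(ℝ, E') π x v = 0 ↔ v ∈ D x := by
  obtain ⟨r, S, _, _, f, _, _, _, _, hfs, -, hdf, hrange⟩ := (π x).isLeaf.1
  have hmem : ∀ {z}, z ∈ Set.range f ↔ π z = π x := fun {z} => by
    rw [hrange]; exact LeafSpace.mem_carrier_iff hπ
  have hdπ : ∀ z, MDifferentiableAt 𝓘(ℝ, E) 𝓘(ℝ, E') π z := fun z =>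
    (hsub.contMDiff z).mdifferentiableAt (by simp)
  obtain ⟨s, rfl⟩ := hmem.2 (rfl : π x = π x)
  obtain ⟨hinj, hran⟩ := hdf s
  obtain ⟨F, _, _, φ, ψ, e, hx, h⟩ := hsub.exists_charts (f s)
  have : FiniteDimensional ℝ (E' × F) := e.toLinearEquiv.finiteDimensional
  have : FiniteDimensional ℝ (TangentSpace 𝓘(ℝ, E) (f s)) := inferInstanceAs (FiniteDimensional ℝ E)
  have : FiniteDimensional ℝ E' :=
    FiniteDimensional.of_surjective (LinearMap.fst ℝ E' F) LinearMap.fst_surjective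
  have : FiniteDimensional ℝ F :=
    FiniteDimensional.of_surjective (LinearMap.snd ℝ E' F) LinearMap.snd_surjective
  -- the leaf is tangent to the kernel
  have hle : D (f s) ≤ LinearMap.ker (mfderiv 𝓘(ℝ, E) 𝓘(ℝ, E') π (f s)).toLinearMap := by
    rw [← hran]
    rintro _ ⟨w, rfl⟩
    have hc : π ∘ f = fun _ => π (f s) := funext fun t => hmem.1 ⟨t, rfl⟩
    have h1 := mfderiv_comp s (hdπ (f s)) ((hfs s).mdifferentiableAt (by simp))
    rw [hc, mfderiv_const] at h1
    exact (DFunLike.congr_fun h1 w).symm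
  -- the kernel is not larger than the leaf
  have hrk : Module.finrank ℝ (D (f s)) = r := by
    rw [← hran, LinearMap.finrank_range_of_inj hinj]
    exact finrank_euclideanSpace_fin
  have hker : Module.finrank ℝ (LinearMap.ker (mfderiv 𝓘(ℝ, E) 𝓘(ℝ, E') π (f s)).toLinearMap)
      = Module.finrank ℝ F := by
    have h1 := LinearMap.finrank_range_add_finrank_ker
      (mfderiv 𝓘(ℝ, E) 𝓘(ℝ, E') π (f s)).toLinearMap
    rw [LinearMap.range_eq_top.2 (h.mfderiv_surjective hx (hdπ _)), finrank_top] at h1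
    have h2 : Module.finrank ℝ E = Module.finrank ℝ E' + Module.finrank ℝ F :=
      e.toLinearEquiv.finrank_eq.trans Module.finrank_prod
    exact Nat.add_left_cancel (h1.trans h2)
  have hdim : Module.finrank ℝ F ≤ r := by
    set T : Set S := f ⁻¹' φ.source
    have hT : IsOpen T := φ.open_source.preimage hfs.continuous
    let g : S → F := fun t => (e (φ (f t))).2
    have hg : ContMDiffOn 𝓘(ℝ, EuclideanSpace ℝ (Fin r)) 𝓘(ℝ, F) ∞ g T := by
      have h1 : ContMDiff 𝓘(ℝ, E) 𝓘(ℝ, F) ∞ fun y => (e y).2 :=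
        ContDiff.contMDiff (by fun_prop)
      exact h1.comp_contMDiffOn
        ((contMDiffOn_of_mem_maximalAtlas h.dom_mem).comp hfs.contMDiffOn fun _ ht => ht)
    set a := (e (φ (f s))).1
    -- The fibre coordinates of the slice through `f s` in the adapted chart, an open subset of `F`.
    let B : Set F := (fun w => e.symm (a, w)) ⁻¹' φ.target
    have hB : IsOpen B := φ.open_target.preimage (by fun_prop)
    have hsB : g s ∈ B := by
      change e.symm (a, (e (φ (f s))).2) ∈ φ.target
      rw [Prod.mk.eta, e.symm_apply_apply]
      exact φ.map_source hx
    -- Every point of the slice has the same image under `π` as `f s`, hence lies on the leaf and is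
    -- some `f t`.
    have hBg : B ⊆ g '' T := by
      intro w hw
      have hz := φ.map_target hw
      have : π (φ.symm (e.symm (a, w))) = π (f s) := by
        refine ψ.injOn (h.mapsTo _ hz) (h.mapsTo _ hx) ?_
        rw [h.apply_eq _ hz, h.apply_eq _ hx, φ.right_inv hw, e.apply_symm_apply]
      obtain ⟨t, ht⟩ := hmem.2 this
      refine ⟨t, by simpa [T, ht] using hz, ?_⟩
      simp only [g, ht]
      rw [φ.right_inv hw, e.apply_symm_apply]
    have h1 : (Module.finrank ℝ F : ENNReal) ≤ r :=
      calc (Module.finrank ℝ F : ENNReal) = dimH B := (Real.dimH_of_mem_nhds (hB.mem_nhds hsB)).symm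
        _ ≤ dimH (g '' T) := dimH_mono hBg
        _ ≤ _ := dimH_image_le_of_contMDiffOn hT hg
        _ = r := by simp
    exact_mod_cast h1
  have heq := Submodule.eq_of_le_of_finrank_le hle (by rw [hker, hrk]; exact hdim)
  rw [heq]
  rfl

end Leaves

/-! ### The transverse complex structure and the involutive limit of `Im N^j`. -/

section TransverseStructure

variable {E : Type*} [NormedAddCommGroup E] [NormedSpace ℝ E] [FiniteDimensional ℝ E]
  {M : Type*} [TopologicalSpace M] [ChartedSpace E M] [IsManifold 𝓘(ℝ, E) ∞ M]
  {E' : Type*} [NormedAddCommGroup E'] [NormedSpace ℝ E'] [FiniteDimensional ℝ E']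
  {N : Type*} [TopologicalSpace N] [ChartedSpace E' N] [IsManifold 𝓘(ℝ, E') ∞ N]
  {j : EndField E M} {k : EndField E' N} {π : M → N}

omit [FiniteDimensional ℝ E] [IsManifold 𝓘(ℝ, E) ∞ M] [FiniteDimensional ℝ E'] in
/-- In a chart of `N`, the fields `j` and `k` are intertwined by the differential of `π`. -/
lemma eventually_vderiv_intertwine (hπ : ContMDiff 𝓘(ℝ, E) 𝓘(ℝ, E') ∞ π)
    (hjk : ∀ (x : M) (v : TangentSpace 𝓘(ℝ, E) x),
      mfderiv 𝓘(ℝ, E) 𝓘(ℝ, E') π x (j x v) = k (π x) (mfderiv 𝓘(ℝ, E) 𝓘(ℝ, E') π x v)) (x : M) :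
    ∀ᶠ z in 𝓝 x, ∀ v : TangentSpace 𝓘(ℝ, E) z,
      vderiv (extChartAt 𝓘(ℝ, E') (π x) ∘ π) z (j z v)
        = k.inCoord (π x) (π z) (vderiv (extChartAt 𝓘(ℝ, E') (π x) ∘ π) z v) := by
  filter_upwards [hπ.continuous.continuousAt.preimage_mem_nhds
    ((chartAt E' (π x)).open_source.mem_nhds (mem_chart_source E' (π x)))] with z hz v
  have h1 := (hπ z).mdifferentiableAt (by simp)
  have h2 := mdifferentiableAt_extChartAt (I := 𝓘(ℝ, E')) hz
  rw [vderiv_comp h2 h1, vderiv_comp h2 h1, hjk]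
  exact k.vderiv_extChartAt_apply hz _

omit [FiniteDimensional ℝ E] [IsManifold 𝓘(ℝ, E) ∞ M] [FiniteDimensional ℝ E']
  [IsManifold 𝓘(ℝ, E') ∞ N] in
lemma contMDiffAt_extChartAt_comp (hπ : ContMDiff 𝓘(ℝ, E) 𝓘(ℝ, E') ∞ π) (x : M) :
    ContMDiffAt 𝓘(ℝ, E) 𝓘(ℝ, E') ∞ (extChartAt 𝓘(ℝ, E') (π x) ∘ π) x :=
  ContMDiffAt.comp x contMDiffAt_extChartAt (hπ x)

omit [FiniteDimensional ℝ E] [IsManifold 𝓘(ℝ, E) ∞ M] [FiniteDimensional ℝ E'] in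
lemma mfderiv_eq_zero_of_vderiv_extChartAt (hπ : ContMDiff 𝓘(ℝ, E) 𝓘(ℝ, E') ∞ π) {x : M}
    {v : TangentSpace 𝓘(ℝ, E) x} (h : vderiv (extChartAt 𝓘(ℝ, E') (π x) ∘ π) x v = 0) :
    mfderiv 𝓘(ℝ, E) 𝓘(ℝ, E') π x v = 0 := by
  rw [vderiv_comp (mdifferentiableAt_extChartAt (mem_chart_source E' _))
    ((hπ x).mdifferentiableAt (by simp))] at h
  exact (vderiv_chart_bijective (IsManifold.chart_mem_maximalAtlas (I := 𝓘(ℝ, E')) (π x))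
    (mem_chart_source E' (π x))).1 (h.trans (map_zero _).symm)

omit [FiniteDimensional ℝ E'] in
-- Apply `vderiv_lieDeriv` with `J` the matrix of `k` composed with `π`: such a `J` has zero
-- derivative along the vertical field `F`.
lemma mfderiv_lieDeriv_eq_zero (hπ : ContMDiff 𝓘(ℝ, E) 𝓘(ℝ, E') ∞ π) (hj : j.Smooth) (hk : k.Smooth)
    (hjk : ∀ (x : M) (v : TangentSpace 𝓘(ℝ, E) x),
      mfderiv 𝓘(ℝ, E) 𝓘(ℝ, E') π x (j x v) = k (π x) (mfderiv 𝓘(ℝ, E) 𝓘(ℝ, E') π x v))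
    {F U : VField E M} (hF : F.Smooth) (hU : U.Smooth)
    (hFπ : ∀ x, mfderiv 𝓘(ℝ, E) 𝓘(ℝ, E') π x (F x) = 0) (x : M) :
    mfderiv 𝓘(ℝ, E) 𝓘(ℝ, E') π x (j.lieDeriv F U x) = 0 := by
  have := FiniteDimensional.complete ℝ E
  refine mfderiv_eq_zero_of_vderiv_extChartAt hπ ?_
  have hK := (hk.inCoord (π x)).mdifferentiableAt (by simp)
  have hπx := (hπ x).mdifferentiableAt (by simp)
  have hF0 : ∀ᶠ z in 𝓝 x, vderiv (extChartAt 𝓘(ℝ, E') (π x) ∘ π) z (F z) = 0 := by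
    filter_upwards [hπ.continuous.continuousAt.preimage_mem_nhds
      ((chartAt E' (π x)).open_source.mem_nhds (mem_chart_source E' (π x)))] with z hz
    rw [vderiv_comp (mdifferentiableAt_extChartAt hz) ((hπ z).mdifferentiableAt (by simp)), hFπ,
      map_zero]
  rw [vderiv_lieDeriv (J := k.inCoord (π x) ∘ π) hj (contMDiffAt_extChartAt_comp hπ x)
    (hK.comp x hπx) (eventually_vderiv_intertwine hπ hjk x) hF hU hF0,
    vderiv_comp hK hπx, hFπ, map_zero]
  rfl

/-- The formula of `vderiv_nijenhuis` is applied twice, to `ψ ∘ π` on `M` and to the chart `ψ` on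
`N`. By the chain rule both give the same expression, and the second is zero by integrability of
`k`. -/
lemma mfderiv_nijenhuis_eq_zero [T2Space N] (hπ : ContMDiff 𝓘(ℝ, E) 𝓘(ℝ, E') ∞ π)
    (hj : j.Smooth) (hk : k.Smooth)
    (hjk : ∀ (x : M) (v : TangentSpace 𝓘(ℝ, E) x),
      mfderiv 𝓘(ℝ, E) 𝓘(ℝ, E') π x (j x v) = k (π x) (mfderiv 𝓘(ℝ, E) 𝓘(ℝ, E') π x v))
    (hint : ∀ X Y : VField E' N, X.Smooth → Y.Smooth → k.nijenhuis X Y = 0)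
    {X Y : VField E M} (hX : X.Smooth) (hY : Y.Smooth) (x : M) :
    mfderiv 𝓘(ℝ, E) 𝓘(ℝ, E') π x (j.nijenhuis X Y x) = 0 := by
  have := FiniteDimensional.complete ℝ E
  have := FiniteDimensional.complete ℝ E'
  refine mfderiv_eq_zero_of_vderiv_extChartAt hπ ?_
  have hK := (hk.inCoord (π x)).mdifferentiableAt (by simp)
  have hπx := (hπ x).mdifferentiableAt (by simp)
  have hψ := mdifferentiableAt_extChartAt (I := 𝓘(ℝ, E')) (mem_chart_source E' (π x))
  -- Any fields on `N` with the right values at the single point `π x` will do; they need not be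
  -- related to `X` and `Y` elsewhere.
  obtain ⟨X', hX', eX⟩ := VField.exists_smooth_eq (π x) (mfderiv 𝓘(ℝ, E) 𝓘(ℝ, E') π x (X x))
  obtain ⟨Y', hY', eY⟩ := VField.exists_smooth_eq (π x) (mfderiv 𝓘(ℝ, E) 𝓘(ℝ, E') π x (Y x))
  have h0 : vderiv (extChartAt 𝓘(ℝ, E') (π x)) (π x) (k.nijenhuis X' Y' (π x)) = 0 := by
    rw [hint X' Y' hX' hY']; exact map_zero _
  rw [vderiv_nijenhuis hk contMDiffAt_extChartAt hK (by
    filter_upwards [(chartAt E' (π x)).open_source.mem_nhds (mem_chart_source E' (π x))] with z hz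
    exact fun v => k.vderiv_extChartAt_apply hz v) hX' hY'] at h0
  rw [vderiv_nijenhuis (J := k.inCoord (π x) ∘ π) hj (contMDiffAt_extChartAt_comp hπ x)
    (hK.comp x hπx) (eventually_vderiv_intertwine hπ hjk x) hX hY]
  simp only [vderiv_comp hK hπx, vderiv_comp hψ hπx, hjk, ← eX, ← eY, Function.comp_apply]
  exact h0

variable {D : TangentDistribution E M}

lemma isTransverseComplexStructure_of_submersion [T2Space N] {j : AlmostComplexStructure E M}
    {k : AlmostComplexStructure E' N} (hk : k.IsIntegrable)
    (hπ : ContMDiff 𝓘(ℝ, E) 𝓘(ℝ, E') ∞ π)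
    (hjk : ∀ (x : M) (v : TangentSpace 𝓘(ℝ, E) x), mfderiv 𝓘(ℝ, E) 𝓘(ℝ, E') π x (j.toField x v)
      = k.toField (π x) (mfderiv 𝓘(ℝ, E) 𝓘(ℝ, E') π x v))
    (hstable : ∀ x, ∀ v ∈ D x, j.toField x v ∈ D x)
    (hD : ∀ (x : M) (v : TangentSpace 𝓘(ℝ, E) x), mfderiv 𝓘(ℝ, E) 𝓘(ℝ, E') π x v = 0 ↔ v ∈ D x) :
    IsTransverseComplexStructure D.sections j.toField where
  smooth := j.smooth
  stable F hF := ⟨j.smooth.app hF.1, fun x => hstable x _ (hF.2 x)⟩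
  sq U hU := by
    have : j.toField.app (j.toField.app U) + U = 0 := by
      funext x
      change j.toField x (j.toField x (U x)) + U x = 0
      rw [j.sq, neg_add_cancel]
    rw [this]
    exact ⟨VField.smooth_zero, fun x => zero_mem _⟩
  lie F hF U hU :=
    have := FiniteDimensional.complete ℝ E
    ⟨j.smooth.lieDeriv hF.1 hU, fun x => (hD x _).1 (mfderiv_lieDeriv_eq_zero hπ j.smooth k.smooth
      hjk hF.1 hU (fun x => (hD x _).2 (hF.2 x)) x)⟩
  nijenhuis U V hU hV :=
    have := FiniteDimensional.complete ℝ E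
    ⟨j.smooth.nijenhuis hU hV, fun x => (hD x _).1 (mfderiv_nijenhuis_eq_zero hπ j.smooth k.smooth
      hjk hk hU hV x)⟩

/-- The vector space of smooth sections of a distribution. -/
def TangentDistribution.sectionsSubmodule (D : TangentDistribution E M) :
    Submodule ℝ (VField E M) where
  carrier := D.sections
  zero_mem' := ⟨VField.smooth_zero, fun _ => zero_mem _⟩
  add_mem' hX hY := ⟨hX.1.add hY.1, fun x => add_mem (hX.2 x) (hY.2 x)⟩
  smul_mem' c _ hX := ⟨ContMDiff.const_smul_section hX.1, fun x => (D x).smul_mem c (hX.2 x)⟩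

omit [FiniteDimensional ℝ E] in
-- Induction along the derived sequence: the values of `N^j` and of `L_U j` stay in `D` by
-- transversality of `j`, brackets by involutivity.
lemma limitDistribution_subset_sections {j : AlmostComplexStructure E M}
    (hinv : IsInvolutive D.sections) (hj : IsTransverseComplexStructure D.sections j.toField) :
    j.limitDistribution ⊆ D.sections := by
  suffices h : ∀ n, j.derivedSeq n ≤ D.sectionsSubmodule from Set.iUnion_subset h
  intro n
  induction n with
  | zero =>
    refine Submodule.span_le.2 fun X hX => ⟨hX.1, fun x => ?_⟩
    have : j.imNijenhuis x ≤ D x := Submodule.span_le.2 fun v hv => by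
      obtain ⟨U, V, hU, hV, rfl⟩ := hv
      exact (hj.nijenhuis U V hU hV).2 x
    exact this (hX.2 x)
  | succ n ih =>
    refine sup_le (sup_le ih (Submodule.span_le.2 ?_)) (Submodule.span_le.2 ?_)
    · rintro _ ⟨U, hU, X, hX, rfl⟩
      exact hj.lie U (ih hU) X hX
    · rintro _ ⟨U, hU, U', hU', rfl⟩
      exact hinv U (ih hU) U' (ih hU')

lemma transverseForms_anti {𝒱 𝒲 : Set (VField E M)} (h : 𝒱 ⊆ 𝒲) (j : AlmostComplexStructure E M)
    (p q : ℕ) : transverseForms 𝒲 j p q ≤ transverseForms 𝒱 j p q :=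
  fun _ hα => ⟨hα.1, fun F hF => hα.2 F (h hF)⟩

omit [FiniteDimensional ℝ E] in
lemma exists_dbarCohomology_map {j : AlmostComplexStructure E M}
    {A B : (p q : ℕ) → Submodule ℂ (smoothForms E M (p + q))} (h : ∀ p q, A p q ≤ B p q) (p q : ℕ) :
    ∃ Ψ : DbarCohomology j A p q →ₗ[ℂ] DbarCohomology j B p q,
      ∀ (α : smoothForms E M (p + q)) (hα : α ∈ dbarCocycles j A p q),
        ∃ hα' : α ∈ dbarCocycles j B p q, Ψ (dbarClass hα) = dbarClass hα' := by
  have hc : dbarCocycles j A p q ≤ dbarCocycles j B p q := inf_le_inf_right _ (h p q)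
  have hb : dbarCoboundaries j A p q ≤ dbarCoboundaries j B p q := by
    cases q with
    | zero => exact le_rfl
    | succ q => exact Submodule.comap_mono (Submodule.map_mono (h p q))
  exact ⟨Submodule.mapQ _ _ (Submodule.inclusion hc) fun α hα => hb hα, fun α hα => ⟨hc hα, rfl⟩⟩

end TransverseStructure

/-! ### Smooth dependence of the pullback of an alternating form on form and map. -/

section AlternatingSmooth

variable {E : Type*} [NormedAddCommGroup E] [NormedSpace ℝ E]
  {F : Type*} [NormedAddCommGroup F] [NormedSpace ℝ F]
  {G : Type*} [NormedAddCommGroup G] [NormedSpace ℝ G]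
  {H : Type*} [NormedAddCommGroup H] [NormedSpace ℝ H] {n : ℕ}

lemma ContinuousMultilinearMap.norm_alternatization_le
    (f : ContinuousMultilinearMap ℝ (fun _ : Fin n => F) H) :
    ‖f.alternatization‖ ≤ (n.factorial : ℝ) * ‖f‖ := by
  refine ContinuousAlternatingMap.opNorm_le_bound _ (by positivity) fun v => ?_
  rw [ContinuousMultilinearMap.alternatization_apply_apply]
  refine (norm_sum_le _ _).trans ?_
  have : ∀ σ : Equiv.Perm (Fin n), ‖Equiv.Perm.sign σ • f (v ∘ σ)‖ ≤ ‖f‖ * ∏ i, ‖v i‖ := by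
    intro σ
    have h1 : ‖Equiv.Perm.sign σ • f (v ∘ σ)‖ = ‖f (v ∘ σ)‖ := by
      rcases Int.units_eq_one_or (Equiv.Perm.sign σ) with h | h <;> simp [h]
    rw [h1]
    refine (f.le_opNorm _).trans_eq ?_
    rw [← Equiv.prod_comp σ fun i => ‖v i‖]; rfl
  refine (Finset.sum_le_sum fun σ _ => this σ).trans_eq ?_
  simp [Fintype.card_perm, mul_assoc]

/-- A continuous linear left inverse of the inclusion of alternating maps in multilinear maps. -/
def alternatizationCLM : ContinuousMultilinearMap ℝ (fun _ : Fin n => F) H →L[ℝ] F [⋀^Fin n]→L[ℝ] H :=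
  (n.factorial : ℝ)⁻¹ • LinearMap.mkContinuous
    { toFun := fun f => f.alternatization
      map_add' := fun f g => map_add _ f g
      map_smul' := fun c f => by
        ext v
        simp [ContinuousMultilinearMap.alternatization_apply_apply, Finset.smul_sum, smul_comm c] }
    (n.factorial : ℝ) fun f => f.norm_alternatization_le

lemma alternatizationCLM_apply (f : F [⋀^Fin n]→L[ℝ] H) :
    alternatizationCLM f.toContinuousMultilinearMap = f := by
  ext v
  have h : (f.toContinuousMultilinearMap.alternatization : F [⋀^Fin n]→L[ℝ] H) v
      = (n.factorial : ℝ) • f v := by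
    rw [ContinuousMultilinearMap.alternatization_apply_apply]
    have : ∀ σ : Equiv.Perm (Fin n), Equiv.Perm.sign σ • f (v ∘ σ) = f v := fun σ => by
      rw [show f (v ∘ σ) = Equiv.Perm.sign σ • f v from f.toAlternatingMap.map_perm v σ, smul_smul,
        Int.units_mul_self, one_smul]
    simp [this, Fintype.card_perm, Nat.cast_smul_eq_nsmul]
  change (n.factorial : ℝ)⁻¹ •
    (f.toContinuousMultilinearMap.alternatization : F [⋀^Fin n]→L[ℝ] H) v = f v
  rw [h, inv_smul_smul₀ (by positivity)]

/-- For multilinear maps, composition is analytic in all its data. The alternating case embeds into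
it and returns through the continuous linear retraction `alternatizationCLM`. -/
lemma ContDiffAt.alternating_compContinuousLinearMap [CompleteSpace H] {f : E → G [⋀^Fin n]→L[ℝ] H}
    {g : E → F →L[ℝ] G} {x : E} {m : WithTop ℕ∞} (hf : ContDiffAt ℝ m f x) (hg : ContDiffAt ℝ m g x) :
    ContDiffAt ℝ m (fun y => (f y).compContinuousLinearMap (g y)) x := by
  have h1 : ContDiffAt ℝ m (fun y => (f y).toContinuousMultilinearMap.compContinuousLinearMap
      fun _ => g y) x := by
    have ha := (ContinuousMultilinearMap.analyticAt_uncurry_compContinuousLinearMap (𝕜 := ℝ)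
      (q := ((fun _ : Fin n => g x), (f x).toContinuousMultilinearMap))).contDiffAt (n := m)
    refine ContDiffAt.comp x (g := fun p : (Fin n → F →L[ℝ] G) ×
      ContinuousMultilinearMap ℝ (fun _ : Fin n => G) H => p.2.compContinuousLinearMap p.1)
      (f := fun y => ((fun _ : Fin n => g y), (f y).toContinuousMultilinearMap)) ha ?_
    refine ContDiffAt.prodMk (contDiffAt_pi.2 fun _ => hg) ?_
    exact (ContinuousAlternatingMap.toContinuousMultilinearMapCLM ℝ).contDiff.contDiffAt.comp x hf
  have h2 := (alternatizationCLM (n := n) (F := F) (H := H)).contDiff.contDiffAt.comp x h1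
  refine h2.congr_of_eventuallyEq (Filter.Eventually.of_forall fun y => ?_)
  exact (alternatizationCLM_apply ((f y).compContinuousLinearMap (g y))).symm

end AlternatingSmooth

/-! ### Pullback of forms: smoothness, exterior derivative, Lie derivative, types. -/

section PullbackForms

variable {E : Type*} [NormedAddCommGroup E] [NormedSpace ℝ E]
  {M : Type*} [TopologicalSpace M] [ChartedSpace E M]
  {E' : Type*} [NormedAddCommGroup E'] [NormedSpace ℝ E']
  {N : Type*} [TopologicalSpace N] [ChartedSpace E' N] {n : ℕ}

lemma CForm.pullback_apply (f : M → N) (β : CForm E' N n) (x : M)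
    (v : Fin n → TangentSpace 𝓘(ℝ, E) x) :
    β.pullback f x v = β (f x) fun i => mfderiv 𝓘(ℝ, E) 𝓘(ℝ, E') f x (v i) := rfl

section
variable [IsManifold 𝓘(ℝ, E) ∞ M]

lemma chartSymmDeriv_vderiv {x₀ : M} {y : E} (hy : y ∈ (extChartAt 𝓘(ℝ, E) x₀).target)
    (v : TangentSpace 𝓘(ℝ, E) ((extChartAt 𝓘(ℝ, E) x₀).symm y)) :
    chartSymmDeriv x₀ y (vderiv (extChartAt 𝓘(ℝ, E) x₀) ((extChartAt 𝓘(ℝ, E) x₀).symm y) v) = v := by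
  have h := mfderivWithin_extChartAt_symm_comp_mfderiv_extChartAt (I := 𝓘(ℝ, E)) hy
  rw [modelWithCornersSelf_coe, Set.range_id, mfderivWithin_univ] at h
  exact DFunLike.congr_fun h v

lemma CForm.inChart_vderiv (α : CForm E M n) {x₀ z : M} (hz : z ∈ (extChartAt 𝓘(ℝ, E) x₀).source)
    (v : Fin n → TangentSpace 𝓘(ℝ, E) z) :
    α.inChart x₀ (extChartAt 𝓘(ℝ, E) x₀ z) (fun i => vderiv (extChartAt 𝓘(ℝ, E) x₀) z (v i))
      = α z v := by
  obtain ⟨y, hy, rfl⟩ : ∃ y ∈ (extChartAt 𝓘(ℝ, E) x₀).target, (extChartAt 𝓘(ℝ, E) x₀).symm y = z :=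
    ⟨_, (extChartAt 𝓘(ℝ, E) x₀).map_source hz, (extChartAt 𝓘(ℝ, E) x₀).left_inv hz⟩
  rw [(extChartAt 𝓘(ℝ, E) x₀).right_inv hy]
  exact congrArg (α ((extChartAt 𝓘(ℝ, E) x₀).symm y)) (funext fun i => chartSymmDeriv_vderiv hy (v i))

end

variable [IsManifold 𝓘(ℝ, E) ∞ M] [IsManifold 𝓘(ℝ, E') ∞ N]

lemma CForm.inChart_pullback (β : CForm E' N n) {f : M → N} {x₀ : M} {y₀ : N} {y : E}
    (hy : y ∈ (extChartAt 𝓘(ℝ, E) x₀).target)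
    (hf : MDifferentiableAt 𝓘(ℝ, E) 𝓘(ℝ, E') f ((extChartAt 𝓘(ℝ, E) x₀).symm y))
    (hfy : f ((extChartAt 𝓘(ℝ, E) x₀).symm y) ∈ (extChartAt 𝓘(ℝ, E') y₀).source) :
    (β.pullback f).inChart x₀ y
      = (β.inChart y₀ ((extChartAt 𝓘(ℝ, E') y₀ ∘ f ∘ (extChartAt 𝓘(ℝ, E) x₀).symm) y)).compContinuousLinearMap
        (fderiv ℝ (extChartAt 𝓘(ℝ, E') y₀ ∘ f ∘ (extChartAt 𝓘(ℝ, E) x₀).symm) y) := by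
  ext v
  have hψ := mdifferentiableAt_extChartAt (I := 𝓘(ℝ, E')) (x := y₀)
    (y := f ((extChartAt 𝓘(ℝ, E) x₀).symm y)) (by simpa using hfy)
  have hd : fderiv ℝ (extChartAt 𝓘(ℝ, E') y₀ ∘ f ∘ (extChartAt 𝓘(ℝ, E) x₀).symm) y
      = (vderiv (extChartAt 𝓘(ℝ, E') y₀ ∘ f) ((extChartAt 𝓘(ℝ, E) x₀).symm y)).comp
        (chartSymmDeriv x₀ y) := vderiv_comp_symm hy (hψ.comp _ hf)
  rw [hd, ContinuousAlternatingMap.compContinuousLinearMap_apply]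
  refine (β.inChart_vderiv hfy _).symm.trans ?_
  refine congrArg (β.inChart y₀ _) (funext fun i => ?_)
  exact (vderiv_comp hψ hf _).symm

/-- Smoothness of `f` is required at one point only, because the lemma also serves for local
sections of a submersion. -/
lemma CForm.contDiffAt_inChart_pullback {β : CForm E' N n} (hβ : β ∈ smoothForms E' N n) {f : M → N}
    {x₀ : M} {y : E} (hy : y ∈ (extChartAt 𝓘(ℝ, E) x₀).target)
    (hf : ContMDiffAt 𝓘(ℝ, E) 𝓘(ℝ, E') ∞ f ((extChartAt 𝓘(ℝ, E) x₀).symm y)) :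
    ContDiffAt ℝ ∞ ((β.pullback f).inChart x₀) y := by
  set z := (extChartAt 𝓘(ℝ, E) x₀).symm y with hz
  have hsymm : ContMDiffAt 𝓘(ℝ, E) 𝓘(ℝ, E) ∞ (extChartAt 𝓘(ℝ, E) x₀).symm y :=
    (contMDiffOn_extChartAt_symm x₀).contMDiffAt ((isOpen_extChartAt_target x₀).mem_nhds hy)
  have hft : ContDiffAt ℝ ∞ (extChartAt 𝓘(ℝ, E') (f z) ∘ f ∘ (extChartAt 𝓘(ℝ, E) x₀).symm) y := by
    rw [← contMDiffAt_iff_contDiffAt]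
    exact ContMDiffAt.comp y (contMDiffAt_extChartAt (x := f z)) (ContMDiffAt.comp y hf hsymm)
  have hβ' : ContDiffAt ℝ ∞ (β.inChart (f z))
      ((extChartAt 𝓘(ℝ, E') (f z) ∘ f ∘ (extChartAt 𝓘(ℝ, E) x₀).symm) y) :=
    (hβ (f z)).contDiffAt ((isOpen_extChartAt_target _).mem_nhds (mem_extChartAt_target _))
  refine ((hβ'.comp y hft).alternating_compContinuousLinearMap
    (hft.fderiv_right (m := ∞) le_rfl)).congr_of_eventuallyEq ?_
  have hd : ∀ᶠ z' in 𝓝 z, MDifferentiableAt 𝓘(ℝ, E) 𝓘(ℝ, E') f z' := by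
    have : ContMDiffAt 𝓘(ℝ, E) 𝓘(ℝ, E') 1 f z := hf.of_le (by exact_mod_cast le_top)
    filter_upwards [contMDiffAt_iff_contMDiffAt_nhds (by simp) |>.1 this] with z hz
    exact hz.mdifferentiableAt (by simp)
  filter_upwards [(isOpen_extChartAt_target x₀).mem_nhds hy, hsymm.continuousAt.eventually hd,
    (hf.continuousAt.comp hsymm.continuousAt).preimage_mem_nhds
      (extChartAt_source_mem_nhds (I := 𝓘(ℝ, E')) (f z))] with y' h1 h2 h3
  exact CForm.inChart_pullback β h1 h2 h3

lemma CForm.pullback_mem_smoothForms {β : CForm E' N n} (hβ : β ∈ smoothForms E' N n) {f : M → N}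
    (hf : ContMDiff 𝓘(ℝ, E) 𝓘(ℝ, E') ∞ f) : β.pullback f ∈ smoothForms E M n := fun x₀ _ hy =>
  (CForm.contDiffAt_inChart_pullback (x₀ := x₀) hβ hy (hf _)).contDiffWithinAt

/-- Naturality of the Euclidean exterior derivative, applied to `f` written in the preferred charts
at `x` and `f x`. These are the charts in which both exterior derivatives are computed, so no
independence of the chart is needed. -/
lemma CForm.extDer_pullback {β : CForm E' N n} (hβ : β ∈ smoothForms E' N n) {f : M → N}
    (hf : ContMDiff 𝓘(ℝ, E) 𝓘(ℝ, E') ∞ f) :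
    (β.pullback f : CForm E M n).extDer = β.extDer.pullback f := by
  funext x
  set φ := extChartAt 𝓘(ℝ, E) x with hφ
  set ψ := extChartAt 𝓘(ℝ, E') (f x) with hψ
  have hφx : φ.symm (φ x) = x := extChartAt_to_inv x
  have hsymm : ContMDiffAt 𝓘(ℝ, E) 𝓘(ℝ, E) ∞ φ.symm (φ x) :=
    (contMDiffOn_extChartAt_symm x).contMDiffAt (extChartAt_target_mem_nhds x)
  have hft : ContDiffAt ℝ ∞ (ψ ∘ f ∘ φ.symm) (φ x) := by
    rw [← contMDiffAt_iff_contDiffAt]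
    exact ContMDiffAt.comp _ (by simp only [Function.comp_apply, hφx]; exact contMDiffAt_extChartAt)
      (ContMDiffAt.comp _ (hf _) hsymm)
  have hval : (ψ ∘ f ∘ φ.symm) (φ x) = ψ (f x) := by simp [hφx]
  have hev : (β.pullback f).inChart x =ᶠ[𝓝 (φ x)] fun y =>
      (β.inChart (f x) ((ψ ∘ f ∘ φ.symm) y)).compContinuousLinearMap (fderiv ℝ (ψ ∘ f ∘ φ.symm) y) := by
    have hc : ContinuousAt (f ∘ φ.symm) (φ x) := hf.continuous.continuousAt.comp hsymm.continuousAt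
    have hsrc : ψ.source ∈ 𝓝 ((f ∘ φ.symm) (φ x)) := by
      rw [Function.comp_apply, hφx]; exact extChartAt_source_mem_nhds _
    filter_upwards [extChartAt_target_mem_nhds (I := 𝓘(ℝ, E)) x,
      hc.preimage_mem_nhds hsrc] with y h1 h2
    exact CForm.inChart_pullback β h1 ((hf _).mdifferentiableAt (by simp)) h2
  have h2 : minSmoothness ℝ 2 ≤ ∞ := by
    simpa [minSmoothness_of_isRCLikeNormedField] using ENat.LEInfty.out
  have hd : DifferentiableAt ℝ (β.inChart (f x)) ((ψ ∘ f ∘ φ.symm) (φ x)) := by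
    rw [hval]; exact CForm.differentiableAt_inChart hβ _ (mem_extChartAt_target _)
  have key := hev.extDeriv_eq.trans (extDeriv_pullback hd hft h2)
  have hψd := mdifferentiableAt_extChartAt (I := 𝓘(ℝ, E')) (mem_chart_source E' (f x))
  have hfd := (hf x).mdifferentiableAt (by simp : (∞ : WithTop ℕ∞) ≠ 0)
  -- `chartDeriv x` is the identity of `E`, so this is the chain rule for `ψ ∘ f`.
  have hd' : ∀ v : TangentSpace 𝓘(ℝ, E) x, fderiv ℝ (ψ ∘ f ∘ φ.symm) (φ x) (chartDeriv x v)
      = vderiv ψ (f x) (mfderiv 𝓘(ℝ, E) 𝓘(ℝ, E') f x v) := fun v =>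
    (DFunLike.congr_fun (congrArg (fun A => (fderiv ℝ (ψ ∘ f ∘ φ.symm) (φ x)).comp A)
      mfderiv_extChartAt_self) v).trans
      ((vderiv_eq_fderiv (E := E) (hψd.comp x hfd) v).trans (vderiv_comp hψd hfd v))
  rw [hval] at key
  refine ContinuousAlternatingMap.ext fun v => ?_
  have h1 := DFunLike.congr_fun key fun i => chartDeriv x (v i)
  refine h1.trans ?_
  rw [ContinuousAlternatingMap.compContinuousLinearMap_apply]
  exact congrArg (extDeriv (β.inChart (f x)) (ψ (f x))) (funext fun i => hd' (v i))

omit [IsManifold 𝓘(ℝ, E) ∞ M] in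
lemma vderiv_alternating_apply {W : Type*} [NormedAddCommGroup W] [NormedSpace ℝ W]
    {b : M → W [⋀^Fin n]→L[ℝ] ℂ} {u : Fin n → M → W} {x : M}
    (hb : MDifferentiableAt 𝓘(ℝ, E) 𝓘(ℝ, W [⋀^Fin n]→L[ℝ] ℂ) b x)
    (hu : ∀ i, MDifferentiableAt 𝓘(ℝ, E) 𝓘(ℝ, W) (u i) x)
    (hbu : MDifferentiableAt 𝓘(ℝ, E) 𝓘(ℝ, ℂ) (fun z => b z fun i => u i z) x)
    (v : TangentSpace 𝓘(ℝ, E) x) :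
    vderiv (fun z => b z fun i => u i z) x v = vderiv b x v (fun i => u i x)
      + ∑ i, b x (Function.update (fun i => u i x) i (vderiv (u i) x v)) := by
  obtain ⟨v, rfl⟩ : ∃ v' : E, v' = v := ⟨v, rfl⟩
  rw [← vderiv_eq_fderiv hbu, ← vderiv_eq_fderiv hb]
  simp only [← vderiv_eq_fderiv (hu _)]
  have := fderiv_continuousAlternatingMap_apply_apply hb.differentiableAt_comp_symm
    (fun i => (hu i).differentiableAt_comp_symm) v
  refine this.trans ?_
  simp

/-- The Lie derivative of a pullback along a vector field tangent to the fibres. -/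
lemma CForm.lieDerivVanishes_pullback [FiniteDimensional ℝ E] [FiniteDimensional ℝ E']
    {β : CForm E' N n}
    (hβ : β ∈ smoothForms E' N n) {π : M → N} (hπ : ContMDiff 𝓘(ℝ, E) 𝓘(ℝ, E') ∞ π)
    {F : VField E M} (hF : F.Smooth) (hFπ : ∀ x, mfderiv 𝓘(ℝ, E) 𝓘(ℝ, E') π x (F x) = 0) :
    (β.pullback π : CForm E M n).LieDerivVanishes F := by
  intro X hX x
  have := FiniteDimensional.complete ℝ E
  set ψ := extChartAt 𝓘(ℝ, E') (π x) with hψ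
  have hπd : ∀ z, MDifferentiableAt 𝓘(ℝ, E) 𝓘(ℝ, E') π z := fun z =>
    (hπ z).mdifferentiableAt (by simp)
  have hG := contMDiffAt_extChartAt_comp hπ x
  have hsrc : ∀ᶠ z in 𝓝 x, π z ∈ ψ.source := hπ.continuous.continuousAt.preimage_mem_nhds
      (extChartAt_source_mem_nhds (I := 𝓘(ℝ, E')) (π x))
  have hchain : ∀ {z}, π z ∈ ψ.source → ∀ v : TangentSpace 𝓘(ℝ, E) z, vderiv (ψ ∘ π) z v
      = vderiv ψ (π z) (mfderiv 𝓘(ℝ, E) 𝓘(ℝ, E') π z v) := fun hz v =>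
    vderiv_comp (mdifferentiableAt_extChartAt (by simpa [hψ] using hz)) (hπd _) v
  -- `c` is the coefficient of `β` in the chart `ψ`; its composite `b` with `π` has zero derivative
  -- along `F`.
  let c : N → E' [⋀^Fin n]→L[ℝ] ℂ := fun y => β.inChart (π x) (ψ y)
  let b : M → E' [⋀^Fin n]→L[ℝ] ℂ := c ∘ π
  have hval : ∀ {z}, π z ∈ ψ.source → ∀ v : Fin n → TangentSpace 𝓘(ℝ, E) z,
      β.pullback π z v = b z fun i => vderiv (ψ ∘ π) z (v i) := fun hz v => by
    rw [CForm.pullback_apply, ← CForm.inChart_vderiv β hz]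
    exact congrArg (b _) (funext fun i => (hchain hz _).symm)
  have hc : MDifferentiableAt 𝓘(ℝ, E') 𝓘(ℝ, E' [⋀^Fin n]→L[ℝ] ℂ) c (π x) :=
    (CForm.differentiableAt_inChart hβ (π x) (mem_extChartAt_target _)).mdifferentiableAt.comp (π x)
      (mdifferentiableAt_extChartAt (mem_chart_source E' _))
  have hb : MDifferentiableAt 𝓘(ℝ, E) 𝓘(ℝ, E' [⋀^Fin n]→L[ℝ] ℂ) b x := hc.comp x (hπd x)
  have hu : ∀ i, MDifferentiableAt 𝓘(ℝ, E) 𝓘(ℝ, E') (fun z => vderiv (ψ ∘ π) z (X i z)) x := fun i =>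
    (hG.vderiv_apply (hX i x)).mdifferentiableAt (by simp)
  have hev : (β.pullback π : CForm E M n).evalOn X
      =ᶠ[𝓝 x] fun z => b z fun i => vderiv (ψ ∘ π) z (X i z) := by
    filter_upwards [hsrc] with z hz using hval hz _
  have hbu := (CForm.mdifferentiableAt_evalOn (CForm.pullback_mem_smoothForms hβ hπ) hX
    x).congr_of_eventuallyEq hev.symm
  have hF0 : (fun z => vderiv (ψ ∘ π) z (F z)) =ᶠ[𝓝 x] fun _ => 0 := by
    filter_upwards [hsrc] with z hz
    rw [hchain hz, hFπ, map_zero]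
  -- In the bracket formula the term differentiating `d(ψ ∘ π)(F)` drops out, as that function
  -- vanishes near `x`.
  have hbr : ∀ i, vderiv (fun z => vderiv (ψ ∘ π) z (X i z)) x (F x)
      = vderiv (ψ ∘ π) x (F.bracket (X i) x) := fun i => by
    rw [VField.bracket, vderiv_mlieBracket hG (hF x) (hX i x),
      Filter.EventuallyEq.vderiv_eq (E := E) hF0, vderiv_const, sub_zero]
  have h1 : derivC ((β.pullback π : CForm E M n).evalOn X) x (F x)
      = ∑ i, (β.pullback π : CForm E M n).evalOn (Function.update X i (F.bracket (X i))) x := by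
    refine (Filter.EventuallyEq.vderiv_eq (E := E) hev (F x)).trans ?_
    -- The product rule loses the derivative of `b`; the remaining terms are exactly the bracket
    -- terms of the Lie derivative.
    rw [vderiv_alternating_apply hb hu hbu, vderiv_comp hc (hπd x), hFπ, map_zero]
    refine (zero_add _).trans ?_
    refine Finset.sum_congr rfl fun i _ => ?_
    rw [hbr]
    refine Eq.trans ?_ (hval hsrc.self_of_nhds _).symm
    refine congrArg (b x) (funext fun k => ?_)
    by_cases hk : k = i
    · subst hk; simp
    · simp [hk]
  exact sub_eq_zero.2 h1

lemma evalTypes_pullback {V V' : Type*} [AddCommGroup V] [Module ℝ V] [TopologicalSpace V]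
    [AddCommGroup V'] [Module ℝ V'] [TopologicalSpace V'] {J : V →L[ℝ] V} {J' : V' →L[ℝ] V'}
    {A : V →L[ℝ] V'} (h : ∀ v, A (J v) = J' (A v)) (α : V' [⋀^Fin n]→L[ℝ] ℂ) (P : Finset (Fin n))
    (v : Fin n → V) :
    evalTypes J (α.compContinuousLinearMap A) P v = evalTypes J' α P fun i => A (v i) := by
  unfold evalTypes
  congr 1
  refine Finset.sum_congr rfl fun S _ => ?_
  congr 1
  refine congrArg α (funext fun r => ?_)
  simp only
  split_ifs <;> simp [h]

lemma typeProj_pullback {V V' : Type*} [AddCommGroup V] [Module ℝ V] [TopologicalSpace V]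
    [AddCommGroup V'] [Module ℝ V'] [TopologicalSpace V'] {J : V →L[ℝ] V} {J' : V' →L[ℝ] V'}
    {A : V →L[ℝ] V'} (h : ∀ v, A (J v) = J' (A v)) (p : ℕ) (α : V' [⋀^Fin n]→L[ℝ] ℂ) :
    typeProj J p (α.compContinuousLinearMap A) = (typeProj J' p α).compContinuousLinearMap A := by
  ext v
  rw [ContinuousAlternatingMap.compContinuousLinearMap_apply, typeProj_apply, typeProj_apply]
  exact Finset.sum_congr rfl fun P _ => evalTypes_pullback h α P v

end PullbackForms

/-! ### Transverse forms descend to the base. -/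

section Descent

/-- Exchange the arguments one slot at a time; each exchange changes the value by a term with a slot
in `K`. -/
lemma ContinuousAlternatingMap.map_congr_of_sub_mem {V : Type*} [AddCommGroup V] [Module ℝ V]
    [TopologicalSpace V] {n : ℕ} {α : V [⋀^Fin n]→L[ℝ] ℂ} {K : Submodule ℝ V}
    (hα : ∀ v : Fin n → V, (∃ i, v i ∈ K) → α v = 0) {v v' : Fin n → V}
    (h : ∀ i, v i - v' i ∈ K) : α v = α v' := by
  have key : ∀ S : Finset (Fin n), α (S.piecewise v v') = α v' := fun S => by
    induction S using Finset.induction_on with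
    | empty => rw [Finset.piecewise_empty]
    | insert k S hk ih =>
      have hw : Function.update (S.piecewise v v') k (v' k) = S.piecewise v v' := by
        rw [← Finset.piecewise_eq_of_notMem S v v' hk, Function.update_eq_self]
      have hadd : α (Function.update (S.piecewise v v') k (v' k + (v k - v' k)))
          = α (Function.update (S.piecewise v v') k (v' k))
            + α (Function.update (S.piecewise v v') k (v k - v' k)) :=
        α.toMultilinearMap.map_update_add _ _ _ _
      rw [Finset.piecewise_insert, ← ih, ← add_sub_cancel (v' k) (v k), hadd, hw,
        hα (Function.update (S.piecewise v v') k (v k - v' k)) ⟨k, by rw [Function.update_self]; exact h k⟩,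
        add_zero]
  simpa using key Finset.univ

variable {E : Type*} [NormedAddCommGroup E] [NormedSpace ℝ E] [FiniteDimensional ℝ E]
  {M : Type*} [TopologicalSpace M] [ChartedSpace E M] [IsManifold 𝓘(ℝ, E) ∞ M]
  {E' : Type*} [NormedAddCommGroup E'] [NormedSpace ℝ E']
  {N : Type*} [TopologicalSpace N] [ChartedSpace E' N]
  {F : Type*} [NormedAddCommGroup F] [NormedSpace ℝ F] {n : ℕ}
  {π : M → N} {φ : OpenPartialHomeomorph M E} {ψ : OpenPartialHomeomorph N E'}
  {e : E ≃L[ℝ] E' × F} {D : TangentDistribution E M}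

section
variable [T2Space M]

/-- Transversality is tested on global sections of `D` only. Vertical fields constant in an adapted
chart become such sections after a cut-off, because `D = ker dπ` contains their multiples. -/
lemma IsProjectionInCharts.exists_section (h : IsProjectionInCharts π φ ψ e)
    (hπ : MDifferentiable 𝓘(ℝ, E) 𝓘(ℝ, E') π)
    (hD : ∀ (x : M) (v : TangentSpace 𝓘(ℝ, E) x), mfderiv 𝓘(ℝ, E) 𝓘(ℝ, E') π x v = 0 ↔ v ∈ D x)
    {x : M} (hx : x ∈ φ.source) (c : F) :
    ∃ V ∈ D.sections, V =ᶠ[𝓝 x] chartField φ (e.symm (0, c)) := by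
  have := FiniteDimensional.complete ℝ E
  obtain ⟨X, hX, h1, h2, h3⟩ := VField.exists_smooth_eventuallyEq φ.open_source
    (chartField_smoothOn h.dom_mem (e.symm (0, c))) hx
  refine ⟨X, ⟨hX, fun z => ?_⟩, h1⟩
  by_cases hz : z ∈ φ.source
  · obtain ⟨r, hr⟩ := h2 z hz
    rw [hr]
    refine (D z).smul_mem r ((hD z _).1 ((h.mfderiv_eq_zero_iff hz (hπ z) _).2 ?_))
    rw [vderiv_chartField h.dom_mem _ hz, e.apply_symm_apply]
  · rw [h3 z hz]; exact (D z).zero_mem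

lemma IsProjectionInCharts.exists_section_eq (h : IsProjectionInCharts π φ ψ e)
    (hπ : MDifferentiable 𝓘(ℝ, E) 𝓘(ℝ, E') π)
    (hD : ∀ (x : M) (v : TangentSpace 𝓘(ℝ, E) x), mfderiv 𝓘(ℝ, E) 𝓘(ℝ, E') π x v = 0 ↔ v ∈ D x)
    {x : M} (hx : x ∈ φ.source) {v : TangentSpace 𝓘(ℝ, E) x} (hv : v ∈ D x) :
    ∃ V ∈ D.sections, V x = v := by
  obtain ⟨V, hV, h1⟩ := h.exists_section hπ hD hx (e (vderiv φ x v)).2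
  refine ⟨V, hV, (vderiv_chart_bijective h.dom_mem hx).1 ?_⟩
  have h0 := (h.mfderiv_eq_zero_iff hx (hπ x) v).1 ((hD x v).2 hv)
  rw [h1.self_of_nhds, vderiv_chartField h.dom_mem _ hx, ← h0]
  exact e.symm_apply_apply _

lemma IsProjectionInCharts.apply_eq_of_mfderiv_eq (h : IsProjectionInCharts π φ ψ e)
    (hπ : MDifferentiable 𝓘(ℝ, E) 𝓘(ℝ, E') π)
    (hD : ∀ (x : M) (v : TangentSpace 𝓘(ℝ, E) x), mfderiv 𝓘(ℝ, E) 𝓘(ℝ, E') π x v = 0 ↔ v ∈ D x)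
    {α : CForm E M n} (hc : ∀ V ∈ D.sections, α.ContractionVanishes V)
    {x : M} (hx : x ∈ φ.source) {v v' : Fin n → TangentSpace 𝓘(ℝ, E) x}
    (hv : ∀ i, mfderiv 𝓘(ℝ, E) 𝓘(ℝ, E') π x (v i) = mfderiv 𝓘(ℝ, E) 𝓘(ℝ, E') π x (v' i)) :
    α x v = α x v' := by
  refine ContinuousAlternatingMap.map_congr_of_sub_mem (K := D x) ?_ fun i => ?_
  · rintro w ⟨i, hi⟩
    obtain ⟨V, hV, hVx⟩ := h.exists_section_eq hπ hD hx hi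
    exact hc V hV x w ⟨i, hVx.symm⟩
  · rw [← hD, map_sub, hv, sub_self]

/-- The vanishing of a Lie derivative is stated for global smooth fields, so chart fields must be
replaced by global ones with the same germ. -/
lemma exists_smooth_evalOn_eventuallyEq (hφ : φ ∈ IsManifold.maximalAtlas 𝓘(ℝ, E) ∞ M)
    (α : CForm E M n) {z : M} (hz : z ∈ φ.source) (a : Fin n → E) :
    ∃ X : Fin n → VField E M, (∀ i, (X i).Smooth) ∧ (∀ i, X i =ᶠ[𝓝 z] chartField φ (a i)) ∧
      α.evalOn X =ᶠ[𝓝 z] α.evalOn fun i => chartField φ (a i) := by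
  have := FiniteDimensional.complete ℝ E
  choose X hX h1 h2 h3 using fun i => VField.exists_smooth_eventuallyEq φ.open_source
    (chartField_smoothOn hφ (a i)) hz
  refine ⟨X, hX, h1, ?_⟩
  filter_upwards [Filter.eventually_all.2 h1] with y hy
  exact congrArg (α y) (funext fun i => hy i)

/-- A transverse form evaluated on fields which are constant in an adapted chart has zero derivative
along the fibres. -/
lemma IsProjectionInCharts.vderiv_evalOn_chartField (h : IsProjectionInCharts π φ ψ e)
    (hπ : MDifferentiable 𝓘(ℝ, E) 𝓘(ℝ, E') π)
    (hD : ∀ (x : M) (v : TangentSpace 𝓘(ℝ, E) x), mfderiv 𝓘(ℝ, E) 𝓘(ℝ, E') π x v = 0 ↔ v ∈ D x)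
    {α : CForm E M n} (hα : α ∈ smoothForms E M n) (hL : ∀ V ∈ D.sections, α.LieDerivVanishes V)
    {z : M} (hz : z ∈ φ.source) (a : Fin n → E) (c : F) :
    MDifferentiableAt 𝓘(ℝ, E) 𝓘(ℝ, ℂ) (α.evalOn fun i => chartField φ (a i)) z ∧
    vderiv (α.evalOn fun i => chartField φ (a i)) z (chartField φ (e.symm (0, c)) z) = 0 := by
  have := FiniteDimensional.complete ℝ E
  obtain ⟨X, hX, hXa, hev⟩ := exists_smooth_evalOn_eventuallyEq h.dom_mem α hz a
  refine ⟨(CForm.mdifferentiableAt_evalOn hα hX z).congr_of_eventuallyEq hev.symm, ?_⟩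
  obtain ⟨V, hV, hVc⟩ := h.exists_section hπ hD hz c
  have hφ := contMDiffAt_of_mem_maximalAtlas h.dom_mem hz
  have hconst : ∀ {Y : VField E M} {b : E}, Y =ᶠ[𝓝 z] chartField φ b →
      (fun y => vderiv φ y (Y y)) =ᶠ[𝓝 z] fun _ => b := fun hY => by
    filter_upwards [hY, φ.open_source.mem_nhds hz] with y h1 h2
    rw [h1, vderiv_chartField h.dom_mem _ h2]
  -- Near `z` both fields are constant in the chart `φ`, so they commute.
  have hbr : ∀ i, V.bracket (X i) z = 0 := fun i => by
    refine (vderiv_chart_bijective h.dom_mem hz).1 ?_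
    rw [VField.bracket, vderiv_mlieBracket hφ (hV.1 z) (hX i z),
      Filter.EventuallyEq.vderiv_eq (E := E) (hconst hVc),
      Filter.EventuallyEq.vderiv_eq (E := E) (hconst (hXa i)), vderiv_const, vderiv_const, sub_zero,
      map_zero]
  rw [← Filter.EventuallyEq.vderiv_eq (E := E) hev, ← hVc.self_of_nhds]
  refine (sub_eq_zero.1 (hL V hV X hX z)).trans (Finset.sum_eq_zero fun i _ => ?_)
  exact (α z).map_coord_zero i (by rw [Function.update_self]; exact hbr i)

/-- Extend the `v i` by fields constant in the adapted chart. The value `G` of `α` on them has zero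
derivative along the slice through `x`, hence is constant on a ball of it. At `z` the extended
vectors have the same images under `dπ` as the `v' i`, which determine the value of `α`. Images
under `dπ` are compared in the model space `E'`, which is meaningful because `π z = π x`. -/
lemma IsProjectionInCharts.eventually_apply_eq (h : IsProjectionInCharts π φ ψ e)
    (hπ : MDifferentiable 𝓘(ℝ, E) 𝓘(ℝ, E') π)
    (hD : ∀ (x : M) (v : TangentSpace 𝓘(ℝ, E) x), mfderiv 𝓘(ℝ, E) 𝓘(ℝ, E') π x v = 0 ↔ v ∈ D x)
    {α : CForm E M n} (hα : α ∈ smoothForms E M n) (hc : ∀ V ∈ D.sections, α.ContractionVanishes V)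
    (hL : ∀ V ∈ D.sections, α.LieDerivVanishes V) {x : M} (hx : x ∈ φ.source) :
    ∀ᶠ z in 𝓝 x, π z = π x → ∀ (v : Fin n → TangentSpace 𝓘(ℝ, E) x)
      (v' : Fin n → TangentSpace 𝓘(ℝ, E) z),
      (∀ i, (mfderiv 𝓘(ℝ, E) 𝓘(ℝ, E') π x (v i) : E') = mfderiv 𝓘(ℝ, E) 𝓘(ℝ, E') π z (v' i)) →
      α x v = α z v' := by
  set b : E' := (e (φ x)).1 with hb
  -- Parametrizes, in the chart, the slice of the fibre through `x`.
  let κ : F → E := fun w => e.symm (b, w)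
  have hκ : Continuous κ := e.symm.continuous.comp (by fun_prop)
  have hκx : κ (e (φ x)).2 = φ x := e.symm_apply_apply _
  obtain ⟨r, hr, hball⟩ := Metric.mem_nhds_iff.1 (hκ.continuousAt.preimage_mem_nhds
    (by rw [hκx]; exact φ.open_target.mem_nhds (φ.map_source hx)) : κ ⁻¹' φ.target ∈ 𝓝 (e (φ x)).2)
  have hsnd : ContinuousAt (fun z => (e (φ z)).2) x :=
    (continuous_snd.comp e.continuous).continuousAt.comp (φ.continuousAt hx)
  filter_upwards [φ.open_source.mem_nhds hx, hsnd.preimage_mem_nhds (Metric.ball_mem_nhds _ hr)]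
    with z hz hzr hπz v v' hv
  have hκz : κ (e (φ z)).2 = φ z := by
    rw [← e.symm_apply_apply (φ z)]
    simp only [κ, hb, ← h.apply_eq x hx, ← hπz, h.apply_eq z hz, e.apply_symm_apply]
  let a : Fin n → E := fun i => vderiv φ x (v i)
  let G : M → ℂ := α.evalOn fun i => chartField φ (a i)
  have hGx : G x = α x v := congrArg (α x) (funext fun i =>
    (vderiv_chart_bijective h.dom_mem hx).1 (vderiv_chartField h.dom_mem _ hx))
  have hGz : G z = α z v' := by
    refine h.apply_eq_of_mfderiv_eq hπ hD hc hz fun i => ?_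
    refine (vderiv_chart_bijective h.cod_mem (h.mapsTo z hz)).1 ?_
    rw [h.vderiv_apply hz (hπ z), vderiv_chartField h.dom_mem _ hz,
      ← h.vderiv_apply hx (hπ x)]
    refine (congrArg (fun w : E' => (vderiv ψ (π x) : E' →L[ℝ] E') w) (hv i)).trans ?_
    exact congrArg (fun y => (vderiv ψ y : E' →L[ℝ] E') (mfderiv 𝓘(ℝ, E) 𝓘(ℝ, E') π z (v' i)))
      hπz.symm
  have hder : ∀ w ∈ Metric.ball (e (φ x)).2 r,
      HasFDerivAt (fun w => G (φ.symm (κ w))) (0 : F →L[ℝ] ℂ) w := by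
    intro w hw
    have htgt : κ w ∈ φ.target := hball hw
    have hsrc := φ.map_target htgt
    have hκd : MDifferentiableAt 𝓘(ℝ, F) 𝓘(ℝ, E) κ w := by
      have : DifferentiableAt ℝ κ w :=
        e.symm.differentiableAt.comp w ((differentiableAt_const b).prodMk differentiableAt_id)
      exact this.mdifferentiableAt
    have hι : MDifferentiableAt 𝓘(ℝ, F) 𝓘(ℝ, E) (φ.symm ∘ κ) w :=
      ((OpenPartialHomeomorph.mdifferentiable_of_mem_maximalAtlas
        h.dom_mem).mdifferentiableAt_symm htgt).comp w hκd
    have hφd : MDifferentiableAt 𝓘(ℝ, E) 𝓘(ℝ, E) φ ((φ.symm ∘ κ) w) :=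
      (OpenPartialHomeomorph.mdifferentiable_of_mem_maximalAtlas h.dom_mem).mdifferentiableAt hsrc
    have hG := fun c => h.vderiv_evalOn_chartField hπ hD hα hL hsrc a c
    have hGd : MDifferentiableAt 𝓘(ℝ, E) 𝓘(ℝ, ℂ) G ((φ.symm ∘ κ) w) := (hG 0).1
    have hd : DifferentiableAt ℝ (G ∘ φ.symm ∘ κ) w :=
      mdifferentiableAt_iff_differentiableAt.1 (hGd.comp w hι)
    have hκ' : ∀ c : F, vderiv κ w c = e.symm (0, c) := fun c => by
      have h1 : HasFDerivAt κ ((e.symm : E' × F →L[ℝ] E).comp (.inr ℝ E' F)) w :=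
        e.symm.hasFDerivAt.comp w ((hasFDerivAt_const b w).prodMk (hasFDerivAt_id w))
      exact (DFunLike.congr_fun mfderiv_eq_fderiv c).trans (DFunLike.congr_fun h1.fderiv c)
    -- The slice moves along the constant vertical fields, for which `vderiv_evalOn_chartField`
    -- gives zero derivative.
    have hι' : ∀ c : F, mfderiv 𝓘(ℝ, F) 𝓘(ℝ, E) (φ.symm ∘ κ) w c
        = chartField φ (e.symm (0, c)) ((φ.symm ∘ κ) w) := fun c => by
      refine (vderiv_chart_bijective h.dom_mem hsrc).1 ?_
      refine (vderiv_comp hφd hι c).symm.trans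
        (Eq.trans ?_ (vderiv_chartField h.dom_mem _ hsrc).symm)
      have hev : φ ∘ φ.symm ∘ κ =ᶠ[𝓝 w] κ := by
        filter_upwards [hκ.continuousAt.preimage_mem_nhds (φ.open_target.mem_nhds htgt)] with y hy
          using φ.right_inv hy
      exact (Filter.EventuallyEq.vderiv_eq (E := F) hev c).trans (hκ' c)
    have h0 : fderiv ℝ (G ∘ φ.symm ∘ κ) w = 0 := by
      ext c
      refine (DFunLike.congr_fun mfderiv_eq_fderiv c).symm.trans ((vderiv_comp hGd hι c).trans ?_)
      rw [hι']
      exact (hG c).2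
    exact h0 ▸ hd.hasFDerivAt
  have := Metric.isOpen_ball.is_const_of_fderiv_eq_zero (convex_ball _ _).isPreconnected
    (fun w hw => (hder w hw).differentiableAt.differentiableWithinAt)
    (fun w hw => (hder w hw).fderiv) (Metric.mem_ball_self hr) hzr
  simp only [hκx, hκz, φ.left_inv hx, φ.left_inv hz] at this
  rw [← hGx, ← hGz, this]

end

omit [FiniteDimensional ℝ E] in
/-- A form on the base of a submersion is smooth if its pullback is. -/
lemma CForm.mem_smoothForms_of_pullback [IsManifold 𝓘(ℝ, E') ∞ N]
    (hsub : Manifold.IsSubmersion 𝓘(ℝ, E) 𝓘(ℝ, E') ∞ π) (hsurj : Function.Surjective π)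
    {β : CForm E' N n} (hβ : (β.pullback π : CForm E M n) ∈ smoothForms E M n) :
    β ∈ smoothForms E' N n := by
  intro y₀ y hy
  refine ContDiffAt.contDiffWithinAt ?_
  set q := (extChartAt 𝓘(ℝ, E') y₀).symm y with hq
  have hπ := hsub.contMDiff
  obtain ⟨x, hxq⟩ := hsurj q
  obtain ⟨F, _, _, φ, ψ, e, hx, h⟩ := hsub.exists_charts x
  have hqψ : q ∈ ψ.source := hxq ▸ h.mapsTo x hx
  -- Freezing the fibre coordinate at that of `x` yields a local section `s` of `π` through `x`.
  let κ : E' → E := fun w => e.symm (w, (e (φ x)).2)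
  have hκ : ContDiff ℝ ∞ κ := e.symm.contDiff.comp (contDiff_id.prodMk contDiff_const)
  let s : N → M := fun y => φ.symm (κ (ψ y))
  have hκq : κ (ψ q) = φ x := by
    simp only [κ, ← hxq, h.apply_eq x hx]
    exact e.symm_apply_apply _
  have hψ : ContMDiffAt 𝓘(ℝ, E') 𝓘(ℝ, E') ∞ ψ q := contMDiffAt_of_mem_maximalAtlas h.cod_mem hqψ
  have hs : ContMDiffAt 𝓘(ℝ, E') 𝓘(ℝ, E) ∞ s q := by
    have hκψ : ContMDiffAt 𝓘(ℝ, E') 𝓘(ℝ, E) ∞ (κ ∘ ψ) q := hκ.contMDiff.contMDiffAt.comp q hψ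
    refine ContMDiffAt.comp q ?_ hκψ
    rw [hκq]
    exact contMDiffAt_symm_of_mem_maximalAtlas h.dom_mem (φ.map_source hx)
  have hmem : ∀ᶠ p in 𝓝 q, p ∈ ψ.source ∧ κ (ψ p) ∈ φ.target :=
    (ψ.open_source.eventually_mem hqψ).and
      ((hκ.continuous.continuousAt.comp hψ.continuousAt).eventually_mem
        (φ.open_target.mem_nhds (by rw [Function.comp_apply, hκq]; exact φ.map_source hx)))
  have hsec : ∀ᶠ p in 𝓝 q, π (s p) = p := by
    filter_upwards [hmem] with p hp
    have hsp : s p ∈ φ.source := φ.map_target hp.2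
    refine ψ.injOn (h.mapsTo _ hsp) hp.1 ?_
    rw [h.apply_eq _ hsp, φ.right_inv hp.2, e.apply_symm_apply]
  have hsd : ∀ᶠ p in 𝓝 q, MDifferentiableAt 𝓘(ℝ, E') 𝓘(ℝ, E) s p := by
    have : ContMDiffAt 𝓘(ℝ, E') 𝓘(ℝ, E) 1 s q := hs.of_le (by exact_mod_cast le_top)
    filter_upwards [contMDiffAt_iff_contMDiffAt_nhds (by simp) |>.1 this] with z hz
    exact hz.mdifferentiableAt (by simp)
  -- Since `π ∘ s` is the identity near `q`, `β` agrees there with the pullback by `s` of a smooth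
  -- form.
  have hpull : ∀ᶠ p in 𝓝 q, ((β.pullback π : CForm E M n).pullback s : CForm E' N n) p = β p := by
    filter_upwards [hsec.eventually_nhds, hsd] with p hp hpd
    have hid : π ∘ s =ᶠ[𝓝 p] id := hp
    have hdπ : ∀ v : TangentSpace 𝓘(ℝ, E') p, (mfderiv 𝓘(ℝ, E) 𝓘(ℝ, E') π (s p)
        (mfderiv 𝓘(ℝ, E') 𝓘(ℝ, E) s p v) : E') = v := fun v =>
      (DFunLike.congr_fun (mfderiv_comp p ((hπ _).mdifferentiableAt (by simp)) hpd) v).symm.trans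
        ((DFunLike.congr_fun hid.mfderiv_eq v).trans (DFunLike.congr_fun mfderiv_id v))
    refine ContinuousAlternatingMap.ext fun v => ?_
    refine (congrArg (fun w : Fin n → E' => (β (π (s p)) : E' [⋀^Fin n]→L[ℝ] ℂ) w)
      (funext fun i => hdπ (v i))).trans ?_
    exact congrArg (fun y => (β y : E' [⋀^Fin n]→L[ℝ] ℂ) v) hp.self_of_nhds
  have hsymm : ContinuousAt (extChartAt 𝓘(ℝ, E') y₀).symm y :=
    ((continuousOn_extChartAt_symm y₀).continuousAt
      ((isOpen_extChartAt_target (I := 𝓘(ℝ, E')) y₀).mem_nhds hy))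
  refine (CForm.contDiffAt_inChart_pullback hβ hy hs).congr_of_eventuallyEq ?_
  filter_upwards [hsymm.eventually hpull] with w hw
  exact congrArg (fun γ : E' [⋀^Fin n]→L[ℝ] ℂ =>
    γ.compContinuousLinearMap (chartSymmDeriv y₀ w : E' →L[ℝ] E')) hw.symm

variable [T2Space M]

/-- A transverse form is constant along connected fibres. -/
lemma CForm.apply_eq_of_transverse (hsub : Manifold.IsSubmersion 𝓘(ℝ, E) 𝓘(ℝ, E') ∞ π)
    (hfib : ∀ y, IsPreconnected (π ⁻¹' {y}))
    (hD : ∀ (x : M) (v : TangentSpace 𝓘(ℝ, E) x), mfderiv 𝓘(ℝ, E) 𝓘(ℝ, E') π x v = 0 ↔ v ∈ D x)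
    {α : CForm E M n} (hα : α ∈ smoothForms E M n) (hc : ∀ V ∈ D.sections, α.ContractionVanishes V)
    (hL : ∀ V ∈ D.sections, α.LieDerivVanishes V) {x z : M} (hxz : π x = π z)
    (v : Fin n → TangentSpace 𝓘(ℝ, E) x) (v' : Fin n → TangentSpace 𝓘(ℝ, E) z)
    (hv : ∀ i, (mfderiv 𝓘(ℝ, E) 𝓘(ℝ, E') π x (v i) : E') = mfderiv 𝓘(ℝ, E) 𝓘(ℝ, E') π z (v' i)) :
    α x v = α z v' := by
  have hπ : MDifferentiable 𝓘(ℝ, E) 𝓘(ℝ, E') π := hsub.contMDiff.mdifferentiable (by simp)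
  -- On a connected set, a symmetric and transitive relation that holds between each point and its
  -- neighbours holds between any two points.
  refine (hfib (π z)).induction₂ (fun x z => ∀ (v : Fin n → TangentSpace 𝓘(ℝ, E) x)
    (v' : Fin n → TangentSpace 𝓘(ℝ, E) z),
    (∀ i, (mfderiv 𝓘(ℝ, E) 𝓘(ℝ, E') π x (v i) : E') = mfderiv 𝓘(ℝ, E) 𝓘(ℝ, E') π z (v' i)) →
      α x v = α z v') ?_ ?_ ?_ hxz rfl v v' hv
  · intro y hy
    obtain ⟨F, _, _, φ, ψ, e, hyφ, h⟩ := hsub.exists_charts y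
    filter_upwards [nhdsWithin_le_nhds (h.eventually_apply_eq hπ hD hα hc hL hyφ),
      self_mem_nhdsWithin] with w hw hw' using hw (hw'.trans hy.symm)
  · intro a b c _ _ _ hab hbc v v' hv
    obtain ⟨F, _, _, φ, ψ, e, hbφ, h⟩ := hsub.exists_charts b
    -- Transitivity needs intermediate vectors at `b`, which exist because `dπ` is surjective.
    choose u hu using fun i => h.mfderiv_surjective hbφ (hπ b) (mfderiv 𝓘(ℝ, E) 𝓘(ℝ, E') π a (v i))
    exact (hab v u fun i => (hu i).symm).trans (hbc u v' fun i => (hu i).trans (hv i))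
  · intro a b _ _ hab v v' hv
    exact (hab v' v fun i => (hv i).symm).symm

/-- Transverse forms descend along submersions with connected fibres. -/
lemma CForm.exists_pullback_eq [FiniteDimensional ℝ E'] [IsManifold 𝓘(ℝ, E') ∞ N]
    (hsub : Manifold.IsSubmersion 𝓘(ℝ, E) 𝓘(ℝ, E') ∞ π) (hsurj : Function.Surjective π)
    (hfib : ∀ y, IsPreconnected (π ⁻¹' {y}))
    (hD : ∀ (x : M) (v : TangentSpace 𝓘(ℝ, E) x), mfderiv 𝓘(ℝ, E) 𝓘(ℝ, E') π x v = 0 ↔ v ∈ D x)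
    {α : CForm E M n} (hα : α ∈ smoothForms E M n) (hc : ∀ V ∈ D.sections, α.ContractionVanishes V)
    (hL : ∀ V ∈ D.sections, α.LieDerivVanishes V) :
    ∃ β ∈ smoothForms E' N n, (β.pullback π : CForm E M n) = α := by
  -- A point over each `y` and a linear right inverse of `dπ` there. The choices need not vary
  -- continuously with `y`: the resulting form does not depend on them, and its smoothness is read
  -- off from its pullback.
  have hσ : ∀ y : N, ∃ (x : M) (σ : E' →L[ℝ] TangentSpace 𝓘(ℝ, E) x), π x = y ∧
      ∀ w : E', (mfderiv 𝓘(ℝ, E) 𝓘(ℝ, E') π x (σ w) : E') = w := fun y => by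
    obtain ⟨x, hx⟩ := hsurj y
    obtain ⟨F, _, _, φ, ψ, e, hxφ, h⟩ := hsub.exists_charts x
    obtain ⟨A, hA⟩ : ∃ A : TangentSpace 𝓘(ℝ, E) x →L[ℝ] E', ∀ v, A v
      = mfderiv 𝓘(ℝ, E) 𝓘(ℝ, E') π x v := ⟨mfderiv 𝓘(ℝ, E) 𝓘(ℝ, E') π x, fun _ => rfl⟩
    obtain ⟨σ, hσ⟩ := A.exists_rightInverse_of_surjective (LinearMap.range_eq_top.2 fun w => by
      obtain ⟨v, hv⟩ := h.mfderiv_surjective hxφ ((hsub.contMDiff x).mdifferentiableAt (by simp)) w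
      exact ⟨v, (hA v).trans hv⟩)
    exact ⟨x, σ, hx, fun w => (hA _).symm.trans (DFunLike.congr_fun hσ w)⟩
  choose s σ hs hσ using hσ
  let β : CForm E' N n := fun y => (α (s y)).compContinuousLinearMap (σ y)
  have hβ : (β.pullback π : CForm E M n) = α := by
    funext x
    refine ContinuousAlternatingMap.ext fun v => ?_
    exact CForm.apply_eq_of_transverse hsub hfib hD hα hc hL (hs (π x)) _ v fun i =>
      hσ (π x) (mfderiv 𝓘(ℝ, E) 𝓘(ℝ, E') π x (v i))
  exact ⟨β, CForm.mem_smoothForms_of_pullback hsub hsurj (hβ ▸ hα), hβ⟩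

end Descent

/-! ### The isomorphism in cohomology. -/

section TransverseIso

/-- The fibre is a leaf, the continuous image of a connected manifold. It is thus connected for the
topology of `M`, even if the immersion is not an embedding. -/
lemma LeafSpace.isPreconnected_fiber {E : Type*} [NormedAddCommGroup E] [NormedSpace ℝ E]
    {M : Type u} [TopologicalSpace M] [ChartedSpace E M] {D : TangentDistribution E M}
    {π : M → LeafSpace D} (hπ : ∀ x, x ∈ (π x).carrier) (L : LeafSpace D) :
    IsPreconnected (π ⁻¹' {L}) := by
  obtain ⟨r, S, _, _, f, _, _, _, _, hf, -, -, hrange⟩ := L.isLeaf.1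
  have : π ⁻¹' {L} = Set.range f := by
    rw [hrange]
    ext x
    exact (LeafSpace.mem_carrier_iff hπ).symm
  rw [this]
  exact isPreconnected_range hf.continuous

variable {E : Type*} [NormedAddCommGroup E] [NormedSpace ℝ E] [FiniteDimensional ℝ E]
  {M : Type*} [TopologicalSpace M] [T2Space M] [ChartedSpace E M] [IsManifold 𝓘(ℝ, E) ∞ M]
  {E' : Type*} [NormedAddCommGroup E'] [NormedSpace ℝ E'] [FiniteDimensional ℝ E']
  {N : Type*} [TopologicalSpace N] [ChartedSpace E' N] [IsManifold 𝓘(ℝ, E') ∞ N]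
  {π : M → N} {D : TangentDistribution E M}
  {j : AlmostComplexStructure E M} {k : AlmostComplexStructure E' N}

omit [FiniteDimensional ℝ E] [T2Space M] [IsManifold 𝓘(ℝ, E) ∞ M]
  [FiniteDimensional ℝ E'] [IsManifold 𝓘(ℝ, E') ∞ N] in
-- Both `π` and `dπ` are surjective. No smoothness of the forms is assumed, so this applies to the
-- values of `dbar`, which lie in `CForm`.
lemma CForm.pullback_injective (hsub : Manifold.IsSubmersion 𝓘(ℝ, E) 𝓘(ℝ, E') ∞ π)
    (hsurj : Function.Surjective π) {n : ℕ} :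
    Function.Injective fun β : CForm E' N n => (β.pullback π : CForm E M n) := by
  intro β γ h
  funext y
  obtain ⟨x, rfl⟩ := hsurj y
  obtain ⟨F, _, _, φ, ψ, e, hxφ, hx⟩ := hsub.exists_charts x
  refine ContinuousAlternatingMap.ext fun w => ?_
  choose v hv using fun i => hx.mfderiv_surjective hxφ
    ((hsub.contMDiff x).mdifferentiableAt (by simp)) (w i)
  obtain rfl : (fun i => mfderiv 𝓘(ℝ, E) 𝓘(ℝ, E') π x (v i)) = w := funext hv
  exact DFunLike.congr_fun (congrFun h x) v

/-- Pullback of smooth forms as a linear map. -/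
def pullbackLinear (hπ : ContMDiff 𝓘(ℝ, E) 𝓘(ℝ, E') ∞ π) (n : ℕ) :
    smoothForms E' N n →ₗ[ℂ] smoothForms E M n where
  toFun β := ⟨β.1.pullback π, CForm.pullback_mem_smoothForms β.2 hπ⟩
  map_add' _ _ := rfl
  map_smul' _ _ := rfl

variable (hsub : Manifold.IsSubmersion 𝓘(ℝ, E) 𝓘(ℝ, E') ∞ π)
  (hjk : ∀ (x : M) (v : TangentSpace 𝓘(ℝ, E) x), mfderiv 𝓘(ℝ, E) 𝓘(ℝ, E') π x (j.toField x v)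
      = k.toField (π x) (mfderiv 𝓘(ℝ, E) 𝓘(ℝ, E') π x v))

include hjk in
omit [FiniteDimensional ℝ E] [T2Space M] [FiniteDimensional ℝ E'] in
lemma dbar_pullback (hπ : ContMDiff 𝓘(ℝ, E) 𝓘(ℝ, E') ∞ π) (p q : ℕ)
    (β : smoothForms E' N (p + q)) :
    dbar j p q (pullbackLinear hπ (p + q) β) = (dbar k p q β).pullback π := by
  funext x
  have h : (β.1.pullback π : CForm E M (p + q)).extDer x
    = (β.1.extDer (π x)).compContinuousLinearMap (mfderiv 𝓘(ℝ, E) 𝓘(ℝ, E') π x) :=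
    congrFun (CForm.extDer_pullback β.2 hπ) x
  exact (congrArg (typeProj (j.toField x) p) h).trans (typeProj_pullback (hjk x) p _)

include hsub hjk in
omit [T2Space M] in
lemma pullback_mem_transverseForms_iff (hsurj : Function.Surjective π)
    (hD : ∀ (x : M) (v : TangentSpace 𝓘(ℝ, E) x), mfderiv 𝓘(ℝ, E) 𝓘(ℝ, E') π x v = 0 ↔ v ∈ D x)
    {p q : ℕ} (β : smoothForms E' N (p + q)) :
    pullbackLinear hsub.contMDiff (p + q) β ∈ transverseForms D.sections j p q
      ↔ β ∈ typeForms k p q := by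
  have hev := fun x P v => evalTypes_pullback (hjk x) (β.1 (π x)) P v
  constructor
  · intro h y P hP w
    obtain ⟨x, rfl⟩ := hsurj y
    obtain ⟨F, _, _, φ, ψ, e, hxφ, hx⟩ := hsub.exists_charts x
    choose v hv using fun i => hx.mfderiv_surjective hxφ
      ((hsub.contMDiff x).mdifferentiableAt (by simp)) (w i)
    obtain rfl : (fun i => mfderiv 𝓘(ℝ, E) 𝓘(ℝ, E') π x (v i)) = w := funext hv
    exact (hev x P v).symm.trans (h.1 x P hP v)
  · intro h
    refine ⟨fun x P hP v => (hev x P v).trans (h (π x) P hP _), fun F hF => ⟨?_, ?_⟩⟩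
    · rintro x v ⟨i, hi⟩
      exact (β.1 (π x)).map_coord_zero i (by rw [hi]; exact (hD x _).2 (hF.2 x))
    · exact CForm.lieDerivVanishes_pullback β.2 hsub.contMDiff hF.1 fun x => (hD x _).2 (hF.2 x)

include hsub hjk in
/-- Pullback along a submersion with connected fibres identifies the Dolbeault cohomology of the
base with the transverse Dolbeault cohomology. -/
lemma exists_dolbeaultCohomology_equiv (hsurj : Function.Surjective π)
    (hfib : ∀ y, IsPreconnected (π ⁻¹' {y}))
    (hD : ∀ (x : M) (v : TangentSpace 𝓘(ℝ, E) x), mfderiv 𝓘(ℝ, E) 𝓘(ℝ, E') π x v = 0 ↔ v ∈ D x)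
    (p q : ℕ) :
    ∃ Φ : DolbeaultCohomology k p q ≃ₗ[ℂ] TransverseDolbeaultCohomology D.sections j p q,
      ∀ (β : smoothForms E' N (p + q)) (hβ : β ∈ dbarCocycles k (typeForms k) p q),
        ∃ (α : smoothForms E M (p + q))
          (hα : α ∈ dbarCocycles j (transverseForms D.sections j) p q),
          α.1 = β.1.pullback π ∧ Φ (dbarClass hβ) = dbarClass hα := by
  set P := fun n => pullbackLinear (E := E) hsub.contMDiff n with hP
  have hPinj : ∀ n, Function.Injective (P n) := fun n β γ h =>
    Subtype.ext (CForm.pullback_injective hsub hsurj (congrArg Subtype.val h))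
  have hmem : ∀ {p q : ℕ} (β : smoothForms E' N (p + q)),
      P (p + q) β ∈ transverseForms D.sections j p q ↔ β ∈ typeForms k p q :=
    pullback_mem_transverseForms_iff hsub hjk hsurj hD
  -- Descent gives a smooth form on the base; its type is recovered from that of its pullback.
  have hex : ∀ {p q : ℕ} {α : smoothForms E M (p + q)}, α ∈ transverseForms D.sections j p q →
      ∃ β ∈ typeForms k p q, P (p + q) β = α := fun {p q α} hα => by
    obtain ⟨β, hβ, h⟩ := CForm.exists_pullback_eq hsub hsurj hfib hD α.2
      (fun V hV => (hα.2 V hV).1) fun V hV => (hα.2 V hV).2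
    have h' : P (p + q) ⟨β, hβ⟩ = α := Subtype.ext h
    exact ⟨⟨β, hβ⟩, (hmem _).1 (h' ▸ hα), h'⟩
  have hdbar : ∀ (p q : ℕ) (β : smoothForms E' N (p + q)),
      dbar j p q (P (p + q) β) = (dbar k p q β).pullback π := dbar_pullback hjk hsub.contMDiff
  have hcoc : ∀ β : smoothForms E' N (p + q),
      P (p + q) β ∈ dbarCocycles j (transverseForms D.sections j) p q
        ↔ β ∈ dbarCocycles k (typeForms k) p q := fun β => by
    refine and_congr (hmem β) ?_
    change dbar j p q (P (p + q) β) = 0 ↔ dbar k p q β = 0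
    rw [hdbar]
    exact ⟨fun h => CForm.pullback_injective hsub hsurj h, fun h => by rw [h]; rfl⟩
  let R : dbarCocycles k (typeForms k) p q →ₗ[ℂ] dbarCocycles j (transverseForms D.sections j) p q :=
    (P (p + q)).restrict fun β hβ => (hcoc β).2 hβ
  have hR : Function.Bijective R := by
    refine ⟨fun β γ h => Subtype.ext (hPinj _ (congrArg Subtype.val h)), fun α => ?_⟩
    obtain ⟨β, -, hβ⟩ := hex α.2.1
    exact ⟨⟨β, (hcoc β).1 (hβ ▸ α.2)⟩, Subtype.ext hβ⟩
  have hcob : ∀ β : smoothForms E' N (p + q),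
      P (p + q) β ∈ dbarCoboundaries j (transverseForms D.sections j) p q
        ↔ β ∈ dbarCoboundaries k (typeForms k) p q := by
    cases q with
    | zero => exact fun β => (map_eq_zero_iff _ (hPinj _))
    | succ q =>
      refine fun β => ⟨?_, ?_⟩
      -- A transverse primitive descends too, and injectivity of the pullback turns it into a
      -- primitive on the base.
      · rintro ⟨α, hα, h⟩
        obtain ⟨γ, hγ, rfl⟩ := hex hα
        exact ⟨γ, hγ, CForm.pullback_injective hsub hsurj ((hdbar p q γ).symm.trans h)⟩
      · rintro ⟨γ, hγ, h⟩
        exact ⟨P (p + q) γ, (hmem γ).2 hγ,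
          (hdbar p q γ).trans (congrArg (fun β : CForm E' N _ => β.pullback π) h)⟩
  let Re := LinearEquiv.ofBijective R hR
  refine ⟨Submodule.Quotient.equiv _ _ Re ?_, fun β hβ => ⟨P (p + q) β, (hcoc β).2 hβ, rfl, rfl⟩⟩
  ext α
  obtain ⟨β, rfl⟩ := Re.surjective α
  rw [Submodule.mem_map_equiv, Re.symm_apply_apply]
  exact (hcob β.1).symm

end TransverseIso

end

theorem mainTheorem10
    {E : Type*} [NormedAddCommGroup E] [NormedSpace ℝ E] [FiniteDimensional ℝ E]
    {M : Type u} [TopologicalSpace M] [T2Space M] [SecondCountableTopology M]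
    [ChartedSpace E M] [IsManifold 𝓘(ℝ, E) ∞ M]
    (j : AlmostComplexStructure E M)
    -- a smooth, regular, involutive, `j`-stable distribution
    (D : TangentDistribution E M) (hsmooth : D.IsSmooth) (hreg : D.IsRegular)
    (hinv : IsInvolutive D.sections) (hstable : ∀ x, ∀ v ∈ D x, j.toField x v ∈ D x)
    -- a manifold structure on the space of leaves
    {E' : Type*} [NormedAddCommGroup E'] [NormedSpace ℝ E'] [FiniteDimensional ℝ E']
    [TopologicalSpace (LeafSpace D)] [T2Space (LeafSpace D)]
    [SecondCountableTopology (LeafSpace D)]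
    [ChartedSpace E' (LeafSpace D)] [IsManifold 𝓘(ℝ, E') ∞ (LeafSpace D)]
    -- the canonical projection `π`, which is a submersion
    (π : M → LeafSpace D) (hπ : ∀ x, x ∈ (π x).carrier)
    (hsub : Manifold.IsSubmersion 𝓘(ℝ, E) 𝓘(ℝ, E') ∞ π)
    -- the complex structure on the space of leaves induced by `j`
    (jhat : AlmostComplexStructure E' (LeafSpace D)) (hint : jhat.IsIntegrable)
    (hj : ∀ (x : M) (v : TangentSpace 𝓘(ℝ, E) x),
      mfderiv 𝓘(ℝ, E) 𝓘(ℝ, E') π x (j.toField x v)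
        = jhat.toField (π x) (mfderiv 𝓘(ℝ, E) 𝓘(ℝ, E') π x v)) :
    IsTransverseComplexStructure D.sections j.toField ∧
    ∀ p q : ℕ,
      -- pullback by `π` induces an isomorphism `H^{p,q}(M/D) ≃ H^{p,q}_{𝒟,[j]}(M)`
      (∃ Φ : DolbeaultCohomology jhat p q ≃ₗ[ℂ] TransverseDolbeaultCohomology D.sections j p q,
        ∀ (β : smoothForms E' (LeafSpace D) (p + q))
          (hβ : β ∈ dbarCocycles jhat (typeForms jhat) p q),
          ∃ (α : smoothForms E M (p + q))
            (hα : α ∈ dbarCocycles j (transverseForms D.sections j) p q),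
            α.1 = β.1.pullback π ∧ Φ (dbarClass hβ) = dbarClass hα) ∧
      -- inclusion of forms induces a map `H^{p,q}_{𝒟,[j]}(M) → H^{p,q}_{j trans}(M)`
      (∃ Ψ : TransverseDolbeaultCohomology D.sections j p q →ₗ[ℂ]
            TransverseDolbeaultCohomology j.limitDistribution j p q,
        ∀ (α : smoothForms E M (p + q))
          (hα : α ∈ dbarCocycles j (transverseForms D.sections j) p q),
          ∃ hα' : α ∈ dbarCocycles j (transverseForms j.limitDistribution j) p q,
            Ψ (dbarClass hα) = dbarClass hα') := by
  -- From here on the leaf space enters only through this description of `D`, the surjectivity of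
  -- `π` and the connectedness of its fibres.
  have hD := mfderiv_proj_eq_zero_iff hπ hsub
  have hT := isTransverseComplexStructure_of_submersion hint hsub.contMDiff hj hstable hD
  exact ⟨hT, fun p q => ⟨exists_dolbeaultCohomology_equiv hsub hj (LeafSpace.proj_surjective hπ)
    (LeafSpace.isPreconnected_fiber hπ) hD p q,
    exists_dbarCohomology_map (transverseForms_anti (limitDistribution_subset_sections hinv hT) j)
      p q⟩⟩
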